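/- Let $V=V_\partial\sqcup V_b$ be a finite set of boundary and bulk vertices. To every $x\in V$ associate a nonzero finite-dimensional Hilbert space $\mathcal H_x$, and put $\mathcal H_S=\bigotimes_{x\in S}\mathcal H_x$ for $S\subseteq V$. Let $R$ be a finite-dimensional reference system. Let $\phi=\phi_{VR}=|\phi\rangle\langle\phi|$ be a pure, possibly subnormalized state on $\mathcal H_V\otimes\mathcal H_R$, i.e. $\operatorname{tr}[\phi]\le 1$ (equivalently, $\phi_{VR}$ is a purification of an arbitrary, possibly mixed, background state $\phi_V$). For each $x\in V_b$ let $|\psi_x\rangle\in\mathcal H_x$ be a random vector whose entries in an orthonormal basis are independent standard circularly-symmetric complex Gaussians $(g+ih)/\sqrt2$ ($g,h$ independent real Gaussians of mean $0$ and variance $1$), independently for different $x$. Let $\psi=\bigotimes_{x\in V_b}|\psi_x\rangle\langle\psi_x|$, and let $$\rho=\rho_{V_\partial R}=\operatorname{tr}_{V_b}\big[(I_{V_\partial R}\otimes\psi)\,\phi\big]$$ be the associated random tensor network state. For $A\subseteq V_\partial$ put $\bar A=V_\partial\setminus A$, and let $C(A)=\{\Delta\subseteq V:\Delta\cap V_\partial=A\}$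 be the set of cuts for $A$; write $\Gamma^c=V\setminus\Gamma$. For a subnormalized bipartite state $\omega_{XY}$ let $$H_2(X|Y)_{\omega|\omega}=-\log_2\operatorname{tr}\Big[\big((I\otimes\omega_Y)^{-1/4}\,\omega_{XY}\,(I\otimes\omega_Y)^{-1/4}\big)^2\Big]+\log_2\operatorname{tr}[\omega],$$ the inverse being taken on the support; entropies of subsystems are those of the corresponding reduced states. Let $A\subseteq V_\partial$, $\Gamma_A\in C(A)$ and $K_1,K_2\in\mathbb R$ be such that $$H_2(\Gamma_A\setminus\Delta_A\,|\,\Gamma_A^cR)_{\phi|\phi}\ge K_1\quad\text{for all }\Delta_A\in C(A)\text{ with }\Delta_A\subsetneq\Gamma_A,$$ $$H_2(\Delta_A\setminus\Gamma_A\,|\,\Gamma_AR)_{\phi|\phi}\ge K_2\quad\text{for all }\Delta_A\in C(A)\text{ with }\Gamma_A\subsetneq\Delta_A.$$ Then $$\mathbb E\min_{V_A,V_{\bar A}}\Big\|(V_A\otimes V_{\bar A}\otimes I_R)\,\rho\,(V_A^\dagger\otimes V_{\bar A}^\dagger\otimes I_R)-\phi_{VR}\Big\|_1\le C\,\operatorname{tr}[\phi]^{1/4}\big(2^{-K_1/4}+2^{-K_2/4}\big),$$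 where the minimum is over isometries $V_A:\mathcal H_A\to\mathcal H_{\Gamma_A}$ and $V_{\bar A}:\mathcal H_{\bar A}\to\mathcal H_{\Gamma_A^c}$, $\|\cdot\|_1$ is the trace norm, and the constant $C$ depends only on the number $|V_b|$ of bulk vertices. (The minimum exists for every realization of the tensors, and it is integrable.) -/

import Mathlib

open MeasureTheory ProbabilityTheory
open scoped Matrix Kronecker

noncomputable section

namespace RTN

/-! ### Finite-dimensional quantum states as matrices -/

section States

variable {m n a b : Type*} [Fintype m] [Fintype n] [DecidableEq n]
  [Fintype a] [DecidableEq a] [Fintype b] [DecidableEq b]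

/-- The rank-one operator `|v⟩⟨v|`. -/
def pureState (v : n → ℂ) : Matrix n n ℂ := Matrix.vecMulVec v (star v)

/-- The trace norm (Schatten 1-norm) of a matrix: the sum of its singular values, i.e. of the
square roots of the eigenvalues of `Mᴴ * M`. -/
def traceNorm (M : Matrix m n ℂ) : ℝ :=
  ∑ i, Real.sqrt ((Matrix.isHermitian_conjTranspose_mul_self M).eigenvalues i)

/-- `V : ℂ^n → ℂ^m` is an isometry. -/
def IsIsometry (V : Matrix m n ℂ) : Prop := Vᴴ * V = 1

/-- The partial trace over the first tensor factor. -/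
def traceFirst (ρ : Matrix (a × b) (a × b) ℂ) : Matrix b b ℂ :=
  fun k k' => ∑ i, ρ (i, k) (i, k')

/-- Real powers of a Hermitian matrix by functional calculus. Since `0 ^ s = 0` for real `s ≠ 0`,
negative powers are taken on the support (generalized inverse). -/
def power (ρ : Matrix b b ℂ) (s : ℝ) : Matrix b b ℂ := cfc (fun x : ℝ => x ^ s) ρ

/-- The operator `(I ⊗ ρ_B)^(-1/4) ρ_AB (I ⊗ ρ_B)^(-1/4)`. -/
def sandwiched (ρ : Matrix (a × b) (a × b) ℂ) : Matrix (a × b) (a × b) ℂ :=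
  ((1 : Matrix a a ℂ) ⊗ₖ power (traceFirst ρ) (-(1 / 4))) * ρ *
    ((1 : Matrix a a ℂ) ⊗ₖ power (traceFirst ρ) (-(1 / 4)))

/-- The sandwiched conditional collision entropy `H₂(A|B)_{ρ|ρ}` of a (subnormalized) state
`ρ_AB`, with logarithms to base two. -/
def condH2 (ρ : Matrix (a × b) (a × b) ℂ) : ℝ :=
  - Real.logb 2 ((sandwiched ρ ^ 2).trace.re) + Real.logb 2 (ρ.trace.re)

end States

/-! ### Multipartite systems

The vertex `x` carries the Hilbert space `ℂ^(ι x)`; the subset `S` of vertices carries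
`⨂_{x ∈ S} ℂ^(ι x)`, with product basis indexed by `Cfg ι S`; the reference system is `ℂ^κ`. -/

section Systems

variable {V : Type*} [Fintype V] [DecidableEq V] {ι : V → Type*} {κ : Type*}

/-- Labels of the product basis of `⨂_{x ∈ S} ℂ^(ι x)`. -/
abbrev Cfg (ι : V → Type*) (S : Finset V) := ∀ x : S, ι x

/-- Labels of the product basis of `H_V ⊗ H_R`. -/
abbrev Full (ι : V → Type*) (κ : Type*) := (∀ x, ι x) × κ

/-- Combine a basis label of `S` with one of the complement of `S`. -/
def glue {S : Finset V} (i : Cfg ι S) (c : Cfg ι Sᶜ) : ∀ x, ι x :=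
  fun x => if h : x ∈ S then i ⟨x, h⟩ else c ⟨x, Finset.mem_compl.2 h⟩

/-- Combine a basis label of `S` with one of `T` (used for disjoint `S` and `T`). -/
def glueUnion {S T : Finset V} (i : Cfg ι S) (k : Cfg ι T) : Cfg ι (S ∪ T) :=
  fun x => if h : x.1 ∈ S then i ⟨x.1, h⟩
    else k ⟨x.1, (Finset.mem_union.1 x.2).resolve_left h⟩

variable [∀ x, Fintype (ι x)]

/-- The operator on `H_S ⊗ H_R` obtained from one on `H_V ⊗ H_R` by tracing out all vertices
outside `S`. -/
def reduced (S : Finset V) (M : Matrix (Full ι κ) (Full ι κ) ℂ) :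
    Matrix (Cfg ι S × κ) (Cfg ι S × κ) ℂ :=
  fun p q => ∑ c : Cfg ι Sᶜ, M (glue p.1 c, p.2) (glue q.1 c, q.2)

/-- The reduced operator on `S T R`, for disjoint `S` and `T`, as an operator on
`H_S ⊗ (H_T ⊗ H_R)`. -/
def reducedBipartite (S T : Finset V) (M : Matrix (Full ι κ) (Full ι κ) ℂ) :
    Matrix (Cfg ι S × (Cfg ι T × κ)) (Cfg ι S × (Cfg ι T × κ)) ℂ :=
  (reduced (S ∪ T) M).submatrix (fun p => (glueUnion p.1 p.2.1, p.2.2))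
    (fun p => (glueUnion p.1 p.2.1, p.2.2))

variable [∀ x, DecidableEq (ι x)] [Fintype κ] [DecidableEq κ]

/-- `H₂(S | T R)_{φ|φ}` for disjoint sets of vertices `S` and `T`. -/
def H2 (φ : Matrix (Full ι κ) (Full ι κ) ℂ) (S T : Finset V) : ℝ :=
  condH2 (reducedBipartite S T φ)

/-! ### Random tensor network states

`bd` is the set of boundary vertices; its complement is the set of bulk vertices. -/

/-- `Γ` is a cut for the boundary region `A`, i.e. `Γ ∈ C(A)`. -/
def IsCut (bd A Γ : Finset V) : Prop := Γ ∩ bd = A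

/-- A family of tensors: one vector `|ψ_x⟩ ∈ ℂ^(ι x)` for every bulk vertex `x`. -/
abbrev Tensors (ι : V → Type*) (bd : Finset V) := ∀ x : (bdᶜ : Finset V), ι x → ℂ

/-- The operator `I_{∂R} ⊗ ψ` on `H_V ⊗ H_R`, where `ψ = ⨂_{x bulk} |ψ_x⟩⟨ψ_x|`. -/
def projector (bd : Finset V) (t : Tensors ι bd) : Matrix (Full ι κ) (Full ι κ) ℂ :=
  fun p q => if bd.restrict p.1 = bd.restrict q.1 ∧ p.2 = q.2 then
    ∏ x : (bdᶜ : Finset V), (t x (p.1 x) * star (t x (q.1 x))) else 0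

/-- The tensor network state `ρ_{∂R} = tr_bulk[(I_{∂R} ⊗ ψ) φ]` with background state `φ`. -/
def networkState (bd : Finset V) (φ : Matrix (Full ι κ) (Full ι κ) ℂ) (t : Tensors ι bd) :
    Matrix (Cfg ι bd × κ) (Cfg ι bd × κ) ℂ :=
  reduced bd (projector bd t * φ)

/-- The operator `V_A ⊗ V_Ā ⊗ I_R` from `H_∂ ⊗ H_R = H_A ⊗ H_Ā ⊗ H_R` to
`H_V ⊗ H_R = H_Γ ⊗ H_{Γᶜ} ⊗ H_R`, where `Ā = bd \ A`. -/
def recoveryMap {bd A : Finset V} (hA : A ⊆ bd) (Γ : Finset V)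
    (VA : Matrix (Cfg ι Γ) (Cfg ι A) ℂ) (VB : Matrix (Cfg ι Γᶜ) (Cfg ι (bd \ A)) ℂ) :
    Matrix (Full ι κ) (Cfg ι bd × κ) ℂ :=
  fun p q =>
    VA (Γ.restrict p.1) (Finset.restrict₂ (π := ι) hA q.1) *
    VB (Γᶜ.restrict p.1) (Finset.restrict₂ (π := ι) Finset.sdiff_subset q.1) *
    (if p.2 = q.2 then 1 else 0)

/-- The set of all values of `‖(V_A ⊗ V_Ā ⊗ I) ρ (V_A ⊗ V_Ā ⊗ I)† - φ‖₁`, where `V_A` and `V_Ā`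
range over the isometries `H_A → H_Γ` and `H_Ā → H_{Γᶜ}`. -/
def recoveryErrors {bd A : Finset V} (hA : A ⊆ bd) (Γ : Finset V)
    (φ : Matrix (Full ι κ) (Full ι κ) ℂ) (ρ : Matrix (Cfg ι bd × κ) (Cfg ι bd × κ) ℂ) : Set ℝ :=
  {e | ∃ (VA : Matrix (Cfg ι Γ) (Cfg ι A) ℂ) (VB : Matrix (Cfg ι Γᶜ) (Cfg ι (bd \ A)) ℂ),
    IsIsometry VA ∧ IsIsometry VB ∧
    e = traceNorm ((recoveryMap hA Γ VA VB : Matrix (Full ι κ) (Cfg ι bd × κ) ℂ) * ρ *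
      (recoveryMap hA Γ VA VB : Matrix (Full ι κ) (Cfg ι bd × κ) ℂ)ᴴ - φ)}

/-- The minimal recovery error over all pairs of isometries. -/
def minRecoveryError {bd A : Finset V} (hA : A ⊆ bd) (Γ : Finset V)
    (φ : Matrix (Full ι κ) (Full ι κ) ℂ) (ρ : Matrix (Cfg ι bd × κ) (Cfg ι bd × κ) ℂ) : ℝ :=
  sInf (recoveryErrors hA Γ φ ρ)

end Systems

/-! ### Gaussian random tensors -/

/-- The standard circularly-symmetric complex Gaussian law: the law of `(x + i y) / √2` for
independent standard real Gaussians `x` and `y`. -/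
def stdComplexGaussian : Measure ℂ :=
  ((gaussianReal 0 1).prod (gaussianReal 0 1)).map
    (fun p : ℝ × ℝ => ((p.1 : ℂ) + Complex.I * (p.2 : ℂ)) / ((Real.sqrt 2 : ℝ) : ℂ))

instance : IsProbabilityMeasure stdComplexGaussian :=
  Measure.isProbabilityMeasure_map (by fun_prop)

/-- The joint law of the random tensors: all entries of all tensors at bulk vertices are
independent standard complex Gaussians. -/
def tensorLaw {V : Type*} [Fintype V] [DecidableEq V] (ι : V → Type*) [∀ x, Fintype (ι x)]
    (bd : Finset V) : Measure (Tensors ι bd) :=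
  Measure.pi fun x : (bdᶜ : Finset V) => Measure.pi fun _ : ι x => stdComplexGaussian

end RTN

end

/-!
Cut the vertices into `Γ` and `Γᶜ` and read the vector `v` as a matrix `N` from `H_Γ` to
`H_{Γᶜ} ⊗ H_R` (`cutMatrix`). Contracting `v` with the random vectors at the bulk vertices of `Γ` amounts to
`N * T` for a random matrix `T : H_A → H_Γ` (`cutTensor`) with `𝔼 T Tᴴ = 1`, and likewise on the
side of `Γᶜ`, with an independent random matrix. The network state is pure
(`networkState_pureState`), and applying the recovery isometries to it gives `N T₁ V_Aᵀ` on one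
side and the same expression for the other matrix on the other side
(`recoveryMap_mulVec_networkVec`). It is therefore enough to find, for each side separately, an
isometry `V` with `N T Vᵀ` close to `N` in Hilbert-Schmidt norm.

One side (`exists_oneSided_recovery`). Put `w = N Nᴴ`. Uhlmann's argument
(`exists_isometry_hsSq_sub_le`) gives an isometry with `‖N T Vᵀ - N‖₂² ≤ ‖√(N T Tᴴ Nᴴ) - √w‖₂²`. By
the Powers-Størmer inequality (`exists_sign_hsSq_sub_le`) this is at most `‖N (T Tᴴ - 1) Nᴴ‖₁`, and
a weighted Cauchy-Schwarz inequality bounds it by `(μ tr w + μ⁻¹ ‖X (T Tᴴ - 1) Xᴴ‖₂²) / 2` with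
`X = w^(-1/4) N` (`exists_isometry_hsSq_sub_le_of_decoupled`). The fourth moments of the Gaussian
vectors follow from Wick's formula: at each bulk vertex the expectation is the sum of the two
pairings. Expanding the product over the vertices gives one term for every set `S` of bulk vertices
in `Γ` (`integral_cutTensor_four`). The term `S = ∅` is the square of the mean, and the term of a
nonempty `S` is the trace of the square of the sandwiched operator (`sandwiched_regroup`), that is,
`2 ^ (-H₂(S | Γᶜ R)) tr φ`. As there are at most `2 ^ |V_b|` such sets, the choice
`μ = 2 ^ ((|V_b| - K) / 2)` makes the expected squared error at most `μ tr φ`.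

Both sides (`integrable_minRecoveryError_and_integral_le`). The tensors on the two sides of the cut
are independent (`measurePreserving_splice`), and `𝔼 ‖X T₂‖₂² = ‖X‖₂²` for fixed `X`, so
contracting the other side does not increase the expected error of the first. For rank-one
operators the trace norm distance is controlled by the distance of the vectors
(`traceNorm_pureState_sub_le`). A weighted inequality of means with weight
`c = 2 ^ (|V_b| / 4) * (2 ^ (-K₁ / 4) + 2 ^ (-K₂ / 4))` gives the bound `4 c tr φ`, and `tr φ ≤ (tr φ) ^ (1 / 4)` because
`0 ≤ tr φ ≤ 1`. The minimum is attained, and depends continuously on the tensors, because the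
isometries form a compact set.
-/

noncomputable section

namespace RTN

open scoped ComplexOrder

/-! ### Hilbert-Schmidt norm, functional calculus and the Powers-Størmer inequality -/

section MatrixAnalysis

variable {m n a b g : Type*} [Fintype m] [Fintype n] [Fintype a] [Fintype b] [Fintype g]

/-- The square of the Hilbert-Schmidt norm. -/
def hsSq (M : Matrix m n ℂ) : ℝ := ∑ i, ∑ j, ‖M i j‖ ^ 2

lemma hsSq_nonneg (M : Matrix m n ℂ) : 0 ≤ hsSq M :=
  Finset.sum_nonneg fun _ _ => Finset.sum_nonneg fun _ _ => sq_nonneg _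

lemma trace_mul_conjTranspose_self (M : Matrix m n ℂ) : (M * Mᴴ).trace = (hsSq M : ℂ) := by
  simp only [Matrix.trace, Matrix.diag, Matrix.mul_apply, Matrix.conjTranspose_apply, hsSq,
    Complex.ofReal_sum]
  refine Finset.sum_congr rfl fun i _ => Finset.sum_congr rfl fun j _ => ?_
  rw [RCLike.star_def, Complex.mul_conj, Complex.normSq_eq_norm_sq]

lemma hsSq_eq_re_trace (M : Matrix m n ℂ) : hsSq M = (M * Mᴴ).trace.re := by
  rw [trace_mul_conjTranspose_self, Complex.ofReal_re]

lemma hsSq_eq_re_trace' (M : Matrix m n ℂ) : hsSq M = (Mᴴ * M).trace.re := by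
  rw [hsSq_eq_re_trace, Matrix.trace_mul_comm]

lemma re_trace_conjTranspose (M : Matrix n n ℂ) : (Mᴴ).trace.re = M.trace.re := by
  rw [Matrix.trace_conjTranspose]; simp

lemma hsSq_sub (X Y : Matrix m n ℂ) :
    hsSq (X - Y) = hsSq X + hsSq Y - 2 * (Yᴴ * X).trace.re := by
  have h : (X * Yᴴ).trace.re = (Yᴴ * X).trace.re := by rw [Matrix.trace_mul_comm]
  have h' : (Y * Xᴴ).trace.re = (Yᴴ * X).trace.re := by
    rw [← re_trace_conjTranspose, Matrix.conjTranspose_mul, Matrix.conjTranspose_conjTranspose, h]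
  simp only [hsSq_eq_re_trace, Matrix.conjTranspose_sub, Matrix.mul_sub, Matrix.sub_mul,
    Matrix.trace_sub, Complex.sub_re, h, h']
  ring

lemma hsSq_add_le (X Y : Matrix m n ℂ) : hsSq (X + Y) ≤ 2 * (hsSq X + hsSq Y) := by
  simp only [hsSq, Finset.mul_sum, ← Finset.sum_add_distrib]
  refine Finset.sum_le_sum fun i _ => Finset.sum_le_sum fun j _ => ?_
  have h := norm_add_le (X i j) (Y i j)
  have h0 := norm_nonneg (X i j + Y i j)
  rw [Matrix.add_apply]
  nlinarith [sq_nonneg (‖X i j‖ - ‖Y i j‖)]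

lemma hsSq_smul (c : ℝ) (X : Matrix m n ℂ) : hsSq ((c : ℂ) • X) = c ^ 2 * hsSq X := by
  simp [hsSq, Finset.mul_sum, mul_pow]

/-- The Cauchy-Schwarz inequality for the Hilbert-Schmidt inner product, combined with the
inequality of arithmetic and geometric means. -/
lemma two_re_trace_le (X Y : Matrix m n ℂ) {μ : ℝ} (hμ : 0 < μ) :
    2 * (Yᴴ * X).trace.re ≤ μ * hsSq X + μ⁻¹ * hsSq Y := by
  have h := hsSq_nonneg ((μ : ℂ) • X - Y)
  rw [hsSq_sub, hsSq_smul, Matrix.mul_smul, Matrix.trace_smul, smul_eq_mul,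
    Complex.re_ofReal_mul] at h
  have h2 := mul_nonneg (inv_nonneg.2 hμ.le) h
  have e : μ⁻¹ * (μ ^ 2 * hsSq X + hsSq Y - 2 * (μ * (Yᴴ * X).trace.re)) =
    μ * hsSq X + μ⁻¹ * hsSq Y - 2 * (Yᴴ * X).trace.re := by
    field_simp
  linarith

lemma hsSq_mul_of_isometry [DecidableEq n] (X : Matrix m n ℂ) {V : Matrix g n ℂ}
    (hV : Vᴴ * V = 1) : hsSq (X * Vᴴ) = hsSq X := by
  rw [hsSq_eq_re_trace, hsSq_eq_re_trace, Matrix.conjTranspose_mul,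
    Matrix.conjTranspose_conjTranspose, Matrix.mul_assoc, ← Matrix.mul_assoc Vᴴ, hV,
    Matrix.one_mul]

section CFC
variable [DecidableEq n] {A : Matrix n n ℂ}

lemma continuousOn_spectrum (A : Matrix n n ℂ) (f : ℝ → ℝ) : ContinuousOn f (spectrum ℝ A) :=
  (Matrix.finite_real_spectrum (A := A)).continuousOn f

lemma cfc_mul_cfc (A : Matrix n n ℂ) (f h : ℝ → ℝ) :
    cfc f A * cfc h A = cfc (fun x => f x * h x) A :=
  (cfc_mul f h A (continuousOn_spectrum A f) (continuousOn_spectrum A h)).symm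

lemma cfc_add_cfc (A : Matrix n n ℂ) (f h : ℝ → ℝ) :
    cfc f A + cfc h A = cfc (fun x => f x + h x) A :=
  (cfc_add A f h (continuousOn_spectrum A f) (continuousOn_spectrum A h)).symm

lemma cfc_sub_cfc (A : Matrix n n ℂ) (f h : ℝ → ℝ) :
    cfc f A - cfc h A = cfc (fun x => f x - h x) A :=
  (cfc_sub f h A (continuousOn_spectrum A f) (continuousOn_spectrum A h)).symm

lemma conjTranspose_cfc (A : Matrix n n ℂ) (f : ℝ → ℝ) : (cfc f A)ᴴ = cfc f A :=
  (cfc_predicate f A : IsSelfAdjoint _)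

lemma posSemidef_cfc {f : ℝ → ℝ} (hf : ∀ x ∈ spectrum ℝ A, 0 ≤ f x) :
    (cfc f A).PosSemidef := by
  have h : cfc f A = (cfc (fun x => √(f x)) A)ᴴ * cfc (fun x => √(f x)) A := by
    rw [conjTranspose_cfc, cfc_mul_cfc]
    exact cfc_congr fun x hx => (Real.mul_self_sqrt (hf x hx)).symm
  rw [h]
  exact Matrix.posSemidef_conjTranspose_mul_self _

lemma spectrum_nonneg_of_posSemidef (hA : A.PosSemidef) : ∀ x ∈ spectrum ℝ A, 0 ≤ x := by
  intro x hx
  rw [hA.1.spectrum_real_eq_range_eigenvalues] at hx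
  obtain ⟨i, rfl⟩ := hx
  exact hA.eigenvalues_nonneg i

lemma power_mul_power (hA : A.PosSemidef) {s t : ℝ} (hst : s + t ≠ 0) :
    power A s * power A t = power A (s + t) := by
  rw [power, power, cfc_mul_cfc]
  refine cfc_congr fun x hx => ?_
  have hx0 := spectrum_nonneg_of_posSemidef hA x hx
  exact (Real.rpow_add' hx0 hst).symm

lemma power_one (hA : A.PosSemidef) : power A 1 = A := by
  have : power A 1 = cfc (id : ℝ → ℝ) A := cfc_congr fun x _ => Real.rpow_one x
  rw [this]
  exact cfc_id ℝ A hA.1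

lemma conjTranspose_power (A : Matrix n n ℂ) (s : ℝ) : (power A s)ᴴ = power A s :=
  conjTranspose_cfc _ _

lemma posSemidef_power (hA : A.PosSemidef) (s : ℝ) : (power A s).PosSemidef :=
  posSemidef_cfc fun x hx => Real.rpow_nonneg (spectrum_nonneg_of_posSemidef hA x hx) s

/-- The projection onto the support of a Hermitian matrix. -/
def supportProj (A : Matrix n n ℂ) : Matrix n n ℂ := cfc (fun x : ℝ => if x = 0 then 0 else 1) A

lemma power_mul_power_neg (hA : A.PosSemidef) {s : ℝ} (hs : s ≠ 0) :
    power A s * power A (-s) = supportProj A := by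
  rw [power, power, cfc_mul_cfc]
  refine cfc_congr fun x hx => ?_
  have hx0 := spectrum_nonneg_of_posSemidef hA x hx
  by_cases h : x = 0
  · simp [h, Real.zero_rpow hs]
  · simp only [h, if_false]
    rw [← Real.rpow_add (lt_of_le_of_ne hx0 (Ne.symm h))]; simp

lemma supportProj_mul_self (hA : A.PosSemidef) : supportProj A * A = A := by
  have hid : cfc (fun x : ℝ => x) A = A := cfc_id' ℝ A hA.1
  suffices h : supportProj A * cfc (fun x : ℝ => x) A = cfc (fun x : ℝ => x) A by rwa [hid] at h
  rw [supportProj, cfc_mul_cfc]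
  refine cfc_congr fun x hx => ?_
  by_cases h : x = 0 <;> simp [h]

lemma posSemidef_one_sub_supportProj (A : Matrix n n ℂ) (hA : A.PosSemidef) :
    (1 - supportProj A).PosSemidef := by
  have hA' : IsSelfAdjoint A := hA.1
  rw [← cfc_one ℝ A hA', supportProj, cfc_sub_cfc]
  refine posSemidef_cfc fun x _ => ?_
  by_cases h : x = 0 <;> simp [h]

lemma supportProj_mul_of_self_mul_conjTranspose (N : Matrix n g ℂ) :
    supportProj (N * Nᴴ) * N = N := by
  have h := supportProj_mul_self (Matrix.posSemidef_self_mul_conjTranspose N)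
  have h2 : ((1 - supportProj (N * Nᴴ)) * N) * ((1 - supportProj (N * Nᴴ)) * N)ᴴ = 0 := by
    rw [Matrix.conjTranspose_mul, ← Matrix.mul_assoc, Matrix.mul_assoc (1 - _) N, Matrix.sub_mul,
      h]
    simp
  have h3 := Matrix.self_mul_conjTranspose_eq_zero.1 h2
  rw [Matrix.sub_mul, Matrix.one_mul, sub_eq_zero] at h3
  exact h3.symm

end CFC

lemma re_trace_mul_nonneg [DecidableEq n] {A B : Matrix n n ℂ} (hA : A.PosSemidef)
    (hB : B.PosSemidef) : 0 ≤ (A * B).trace.re := by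
  have h : A = power A (1 / 2) * power A (1 / 2) := by
    rw [power_mul_power hA (by norm_num)]; norm_num; exact (power_one hA).symm
  rw [h, Matrix.mul_assoc, Matrix.trace_mul_comm]
  have := hB.mul_mul_conjTranspose_same (power A (1 / 2))
  rw [conjTranspose_power] at this
  exact (Complex.le_def.1 this.trace_nonneg).1

/-- A form of the Powers-Størmer inequality `‖P - Q‖₂² ≤ ‖P² - Q²‖₁`, in which the trace norm is
replaced by the pairing with a Hermitian contraction `S`. The proof takes `S` to be the sign of
`P - Q`. -/
lemma exists_sign_hsSq_sub_le [DecidableEq n] {P Q : Matrix n n ℂ} (hP : P.PosSemidef)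
    (hQ : Q.PosSemidef) : ∃ S : Matrix n n ℂ, Sᴴ = S ∧ (1 - S * S).PosSemidef ∧
      hsSq (P - Q) ≤ ((P * P - Q * Q) * S).trace.re := by
  set D := P - Q with hD
  have hDh : Dᴴ = D := by rw [hD, Matrix.conjTranspose_sub, hP.1, hQ.1]
  have hDs : IsSelfAdjoint D := hDh
  set S := cfc (fun x : ℝ => (SignType.sign x : ℝ)) D with hS
  set Dp := cfc (fun x : ℝ => max x 0) D with hDp
  set Dm := cfc (fun x : ℝ => max (-x) 0) D with hDm
  have hid : cfc (fun x : ℝ => x) D = D := cfc_id' ℝ D hDs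
  -- `S * D` is the absolute value of `D`, the sum of its positive and negative parts.
  have e1 : S * D = Dp + Dm := by
    conv_lhs => rw [← hid, hS]
    rw [cfc_mul_cfc, hDp, hDm, cfc_add_cfc]
    refine cfc_congr fun x _ => ?_
    show (SignType.sign x : ℝ) * x = max x 0 + max (-x) 0
    rcases lt_trichotomy x 0 with h | h | h
    · simp [h, h.le]
    · simp [h]
    · simp [h, h.le]
  have e2 : D * S = Dp + Dm := by
    rw [← e1]
    conv_lhs => rw [← hid, hS]
    conv_rhs => rw [← hid, hS]
    rw [cfc_mul_cfc, cfc_mul_cfc]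
    exact cfc_congr fun x _ => mul_comm _ _
  have e3 : Dp - Dm = D := by
    rw [hDp, hDm, cfc_sub_cfc]
    conv_rhs => rw [← hid]
    refine cfc_congr fun x _ => ?_
    rcases le_total x 0 with h | h <;> simp [h]
  have hpp : Dp.PosSemidef := posSemidef_cfc fun x _ => le_max_right _ _
  have hmp : Dm.PosSemidef := posSemidef_cfc fun x _ => le_max_right _ _
  refine ⟨S, conjTranspose_cfc _ _, ?_, ?_⟩
  · rw [← cfc_one ℝ D hDs, hS, cfc_mul_cfc, cfc_sub_cfc]
    refine posSemidef_cfc fun x _ => ?_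
    rcases lt_trichotomy x 0 with h | h | h <;> simp [h]
  · -- `P² - Q²` is the symmetrized product of `P - Q` and `P + Q`.
    have k1 : ((P * P - Q * Q) * S).trace = ((P + Q) * (Dp + Dm)).trace := by
      have : (P * P - Q * Q) + (P * P - Q * Q) = D * (P + Q) + (P + Q) * D := by
        rw [hD]; noncomm_ring
      have h2 : ((P * P - Q * Q) * S).trace + ((P * P - Q * Q) * S).trace =
          ((P + Q) * (Dp + Dm)).trace + ((P + Q) * (Dp + Dm)).trace := by
        rw [← Matrix.trace_add, ← Matrix.add_mul, this, Matrix.add_mul, Matrix.trace_add,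
          Matrix.mul_assoc (P + Q), e2, Matrix.mul_assoc, Matrix.trace_mul_comm D,
          Matrix.mul_assoc, e1]
      linear_combination h2 / 2
    have k2 : hsSq D = (D * (Dp - Dm)).trace.re := by rw [hsSq_eq_re_trace, hDh, e3]
    have k3 := re_trace_mul_nonneg hQ hpp
    have k4 := re_trace_mul_nonneg hP hmp
    have k5 : (P + Q) * (Dp + Dm) - D * (Dp - Dm) = Q * Dp + Q * Dp + (P * Dm + P * Dm) := by
      rw [hD]; noncomm_ring
    have k6 := congrArg (fun M => M.trace.re) k5
    simp only [Matrix.trace_add, Matrix.trace_sub, Complex.add_re, Complex.sub_re] at k6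
    rw [k1, k2]
    linarith

end MatrixAnalysis

/-! ### Polar decomposition and Uhlmann isometries -/

section Uhlmann
variable {b a g : Type*} [Fintype a] [Fintype b] [Fintype g]

/-- Polar decomposition with an isometry, available as soon as the domain is not larger than the
codomain: the normalized images of the eigenvectors of `Mᴴ * M` with nonzero eigenvalue are
orthonormal, and they are completed to an orthonormal basis. -/
lemma exists_polar [DecidableEq a] [DecidableEq g] (hag : Fintype.card a ≤ Fintype.card g)
    (M : Matrix g a ℂ) : ∃ (V : Matrix g a ℂ) (P : Matrix a a ℂ),
      Vᴴ * V = 1 ∧ P.PosSemidef ∧ M = V * P := by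
  obtain ⟨e⟩ : Nonempty (a ↪ g) := Function.Embedding.nonempty_of_card_le hag
  have hH := Matrix.posSemidef_conjTranspose_mul_self M
  set U : Matrix a a ℂ := (hH.1.eigenvectorUnitary : Matrix a a ℂ) with hU
  set l : a → ℝ := hH.1.eigenvalues with hl
  have hl0 : ∀ i, 0 ≤ l i := hH.eigenvalues_nonneg
  have hU1 : Uᴴ * U = 1 := Unitary.coe_star_mul_self hH.1.eigenvectorUnitary
  have hU2 : U * Uᴴ = 1 := Unitary.coe_mul_star_self hH.1.eigenvectorUnitary
  have hspec : Mᴴ * M = U * Matrix.diagonal (fun i => (l i : ℂ)) * Uᴴ := hH.1.spectral_theorem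
  set X : Matrix g a ℂ := M * U with hX
  have hXX : Xᴴ * X = Matrix.diagonal (fun i => (l i : ℂ)) := by
    rw [hX, Matrix.conjTranspose_mul, Matrix.mul_assoc, ← Matrix.mul_assoc Mᴴ, hspec]
    rw [Matrix.mul_assoc, Matrix.mul_assoc, hU1, Matrix.mul_one, ← Matrix.mul_assoc, hU1,
      Matrix.one_mul]
  have hXXij : ∀ i j, ∑ k, star (X k i) * X k j = if i = j then (l i : ℂ) else 0 := by
    intro i j
    have := congrFun (congrFun hXX i) j
    simpa [Matrix.mul_apply, Matrix.diagonal_apply] using this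
  set c : a → EuclideanSpace ℂ g := fun i => WithLp.toLp 2 (fun k => ((√(l i))⁻¹ : ℂ) * X k i)
    with hc
  set v : g → EuclideanSpace ℂ g := Function.extend e c 0 with hv
  have hve : ∀ i, v (e i) = c i := fun i => e.injective.extend_apply _ _ _
  have hinner : ∀ i j, inner ℂ (c i) (c j) =
      ((√(l i))⁻¹ : ℂ) * ((√(l j))⁻¹ : ℂ) * (if i = j then (l i : ℂ) else 0) := by
    intro i j
    rw [← hXXij, Finset.mul_sum, PiLp.inner_apply]
    refine Finset.sum_congr rfl fun k _ => ?_
    simp [hc]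
    ring
  have horth : Orthonormal ℂ ((e '' {i | l i ≠ 0}).domRestrict v) := by
    rw [orthonormal_iff_ite]
    rintro ⟨_, i, hi, rfl⟩ ⟨_, j, hj, rfl⟩
    have hne : ((⟨e i, i, hi, rfl⟩ : e '' {i | l i ≠ 0}) = ⟨e j, j, hj, rfl⟩) ↔ i = j := by
      exact Subtype.mk_eq_mk.trans e.injective.eq_iff
    change inner ℂ (v (e i)) (v (e j)) = _
    rw [hve, hve, hinner, if_congr hne rfl rfl]
    by_cases hij : i = j
    · subst hij
      have h1 : (√(l i)) ≠ 0 := by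
        rw [Real.sqrt_ne_zero (hl0 i)]; exact hi
      have h2 : (l i : ℂ) = (√(l i) : ℂ) * (√(l i) : ℂ) := by
        rw [← Complex.ofReal_mul, Real.mul_self_sqrt (hl0 i)]
      have h1' : (√(l i) : ℂ) ≠ 0 := by exact_mod_cast h1
      simp only [if_true]
      rw [h2]; field_simp
    · simp [hij]
  obtain ⟨B, hB⟩ := horth.exists_orthonormalBasis_extension_of_card_eq (by simp)
  set V0 : Matrix g a ℂ := fun k i => B (e i) k with hV0
  have hV0V0 : V0ᴴ * V0 = 1 := by
    ext i j
    have := orthonormal_iff_ite.1 B.orthonormal (e i) (e j)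
    rw [PiLp.inner_apply] at this
    rw [Matrix.mul_apply, Matrix.one_apply,
      show (if i = j then (1 : ℂ) else 0) = if e i = e j then 1 else 0 by
        simp [e.injective.eq_iff], ← this]
    refine Finset.sum_congr rfl fun k _ => ?_
    rw [Matrix.conjTranspose_apply, hV0]
    simp [mul_comm]
  have hXV : X = V0 * Matrix.diagonal (fun i => (√(l i) : ℂ)) := by
    ext k i
    rw [Matrix.mul_diagonal]
    by_cases hi : l i = 0
    · have h0 := hXXij i i
      simp only [if_true, hi, Complex.ofReal_zero] at h0
      have h1 : ∑ k, ‖X k i‖ ^ 2 = 0 := by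
        have : ((∑ k, ‖X k i‖ ^ 2 : ℝ) : ℂ) = 0 := by
          rw [← h0, Complex.ofReal_sum]
          refine Finset.sum_congr rfl fun k _ => ?_
          rw [RCLike.star_def, mul_comm, Complex.mul_conj, Complex.normSq_eq_norm_sq]
        exact_mod_cast this
      have h2 := (Finset.sum_eq_zero_iff_of_nonneg fun k _ => sq_nonneg ‖X k i‖).1 h1 k
        (Finset.mem_univ k)
      have h3 : X k i = 0 := by simpa using h2
      simp [h3, hi]
    · have h1 : (√(l i) : ℂ) ≠ 0 := by
        have : √(l i) ≠ 0 := by rw [Real.sqrt_ne_zero (hl0 i)]; exact hi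
        exact_mod_cast this
      have h2 := hB (e i) ⟨i, hi, rfl⟩
      simp only [hV0, h2, hve, hc]
      field_simp
  refine ⟨V0 * Uᴴ, U * Matrix.diagonal (fun i => (√(l i) : ℂ)) * Uᴴ, ?_, ?_, ?_⟩
  · rw [Matrix.conjTranspose_mul, Matrix.conjTranspose_conjTranspose, Matrix.mul_assoc,
      ← Matrix.mul_assoc V0ᴴ, hV0V0, Matrix.one_mul, hU2]
  · refine Matrix.PosSemidef.mul_mul_conjTranspose_same ?_ U
    refine Matrix.PosSemidef.diagonal fun i => ?_
    exact Complex.zero_le_real.2 (Real.sqrt_nonneg _)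
  · rw [Matrix.mul_assoc U, Matrix.mul_assoc V0, ← Matrix.mul_assoc Uᴴ U, hU1, Matrix.one_mul,
      ← Matrix.mul_assoc V0, ← hXV, hX, Matrix.mul_assoc, hU2, Matrix.mul_one]

/-- The estimate behind Uhlmann's theorem: two purifications `W` and `N` can be aligned by an
isometry `V` at a Hilbert-Schmidt distance no larger than that of the square roots of `W Wᴴ` and `N
Nᴴ`. With the polar decomposition `Nᴴ W = V P`, the overlap of `W Vᴴ` with `N` is `tr P`, while
that of the square roots is `tr (P Z)` for a contraction `Z`. -/
lemma exists_isometry_hsSq_sub_le [DecidableEq b] [DecidableEq a] [DecidableEq g]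
    (hag : Fintype.card a ≤ Fintype.card g) (N : Matrix b g ℂ) (W : Matrix b a ℂ) :
    ∃ V : Matrix g a ℂ, Vᴴ * V = 1 ∧ hsSq (W * Vᴴ - N) ≤
      hsSq (power (W * Wᴴ) (1 / 2) - power (N * Nᴴ) (1 / 2)) := by
  obtain ⟨V, P, hV, hP, hM⟩ := exists_polar hag (Nᴴ * W)
  refine ⟨V, hV, ?_⟩
  set s := W * Wᴴ with hs
  set w := N * Nᴴ with hw
  have hsp : s.PosSemidef := Matrix.posSemidef_self_mul_conjTranspose W
  have hwp : w.PosSemidef := Matrix.posSemidef_self_mul_conjTranspose N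
  set Y : Matrix a g ℂ := Wᴴ * power s (-(1 / 2)) * power w (-(1 / 2)) * N with hY
  clear_value s w Y
  -- `Y` is a contraction, a product of the two partial isometries from polar decompositions.
  have hYc : (1 - Yᴴ * Y).PosSemidef := by
    have h1 : Yᴴ * Y = Nᴴ * power w (-(1 / 2)) * supportProj s * power w (-(1 / 2)) * N := by
      have : power s (-(1 / 2)) * s * power s (-(1 / 2)) = supportProj s := by
        nth_rw 2 [← power_one hsp]
        rw [power_mul_power hsp (by norm_num),
          show (-(1 / 2) : ℝ) + 1 = 1 / 2 by norm_num,
          power_mul_power_neg hsp (by norm_num)]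
      rw [hY, ← this, hs]
      simp only [Matrix.conjTranspose_mul, Matrix.conjTranspose_conjTranspose,
        conjTranspose_power, Matrix.mul_assoc]
    set J : Matrix g g ℂ := Nᴴ * power w (-1) * N with hJ
    have hJh : Jᴴ = J := by
      simp only [hJ, Matrix.conjTranspose_mul, Matrix.conjTranspose_conjTranspose,
        conjTranspose_power, Matrix.mul_assoc]
    have hJJ : J * J = J := by
      have : power w (-1) * w * power w (-1) = power w (-1) := by
        nth_rw 2 [← power_one hwp]
        rw [Matrix.mul_assoc, power_mul_power_neg hwp one_ne_zero, power, supportProj, cfc_mul_cfc]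
        refine cfc_congr fun x hx => ?_
        by_cases h : x = 0 <;> simp [h]
      calc J * J = Nᴴ * (power w (-1) * w * power w (-1)) * N := by
            simp only [hJ, hw, Matrix.mul_assoc]
        _ = J := by rw [this]
    have h2 : 1 - Yᴴ * Y = (1 - J)ᴴ * (1 - J) +
        (power w (-(1 / 2)) * N)ᴴ * (1 - supportProj s) * (power w (-(1 / 2)) * N) := by
      have h3 : (power w (-(1 / 2)) * N)ᴴ * (power w (-(1 / 2)) * N) = J := by
        have : power w (-1) = power w (-(1 / 2)) * power w (-(1 / 2)) := by
          rw [power_mul_power hwp (by norm_num)]; norm_num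
        rw [hJ, this]
        simp only [Matrix.conjTranspose_mul, conjTranspose_power, Matrix.mul_assoc]
      have h4 : (1 - J)ᴴ * (1 - J) = 1 - J := by
        rw [Matrix.conjTranspose_sub, hJh, Matrix.conjTranspose_one, Matrix.mul_sub, Matrix.sub_mul,
          Matrix.sub_mul, hJJ]
        simp
      rw [h4, Matrix.mul_sub, Matrix.sub_mul, Matrix.mul_one, h3, h1]
      simp only [Matrix.conjTranspose_mul, conjTranspose_power, Matrix.mul_assoc]
      abel
    rw [h2]
    exact (Matrix.posSemidef_conjTranspose_mul_self _).add
      ((posSemidef_one_sub_supportProj s hsp).conjTranspose_mul_mul_same _)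
  have hkey : (power s (1 / 2) * power w (1 / 2)).trace = (P * (Y * V)).trace := by
    have h1 : (P * (Y * V)).trace = (Nᴴ * W * Y).trace := by
      rw [hM, ← Matrix.mul_assoc, Matrix.trace_mul_comm, Matrix.mul_assoc V]
    have h2 : s * power s (-(1 / 2)) = power s (1 / 2) := by
      nth_rw 1 [← power_one hsp]
      rw [power_mul_power hsp (by norm_num)]; norm_num
    have h3 : power w (-(1 / 2)) * w = power w (1 / 2) := by
      nth_rw 2 [← power_one hwp]
      rw [power_mul_power hwp (by norm_num)]; norm_num
    rw [h1, ← h2, ← h3, hY]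
    have h4 : Nᴴ * W * (Wᴴ * power s (-(1 / 2)) * power w (-(1 / 2)) * N) =
      Nᴴ * (s * power s (-(1 / 2)) * power w (-(1 / 2)) * N) := by
      simp only [hs, Matrix.mul_assoc]
    rw [h4, Matrix.trace_mul_comm Nᴴ]
    simp only [Matrix.mul_assoc, hw]
  have hle : (P * (Y * V)).trace.re ≤ P.trace.re := by
    obtain ⟨Z, hZ⟩ : ∃ Z, Z = Y * V := ⟨_, rfl⟩
    rw [← hZ]
    have hZc : (1 - Zᴴ * Z).PosSemidef := by
      have := hYc.conjTranspose_mul_mul_same V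
      rwa [Matrix.mul_sub, Matrix.sub_mul, Matrix.mul_one, hV,
        show Vᴴ * (Yᴴ * Y) * V = Zᴴ * Z by
          rw [hZ, Matrix.conjTranspose_mul]; simp only [Matrix.mul_assoc]] at this
    have h1 := (Complex.le_def.1 (hP.mul_mul_conjTranspose_same (1 - Z)).trace_nonneg).1
    have h2 := re_trace_mul_nonneg hP hZc
    have h3 : (Z * P).trace.re = (P * Z).trace.re := by rw [Matrix.trace_mul_comm]
    have h4 : (P * Zᴴ).trace.re = (P * Z).trace.re := by
      rw [← re_trace_conjTranspose, Matrix.conjTranspose_mul, Matrix.conjTranspose_conjTranspose,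
        hP.1, h3]
    have h5 : (Z * (P * Zᴴ)).trace.re = (P * (Zᴴ * Z)).trace.re := by
      rw [Matrix.trace_mul_comm, Matrix.mul_assoc]
    simp only [Matrix.conjTranspose_sub, Matrix.conjTranspose_one, Matrix.sub_mul, Matrix.mul_sub,
      Matrix.one_mul, Matrix.mul_one, Matrix.trace_sub, Complex.sub_re, Complex.zero_re,
      Matrix.mul_assoc, h3, h4, h5] at h1 h2
    linarith
  have hPt : (Nᴴ * (W * Vᴴ)).trace = P.trace := by
    rw [← Matrix.mul_assoc, hM, Matrix.trace_mul_comm, ← Matrix.mul_assoc, hV, Matrix.one_mul]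
  have hroot : ∀ {x : Matrix b b ℂ}, x.PosSemidef →
      hsSq (power x (1 / 2)) = x.trace.re := by
    intro x hx
    rw [hsSq_eq_re_trace, conjTranspose_power, power_mul_power hx (by norm_num),
      show (1 / 2 : ℝ) + 1 / 2 = 1 by norm_num, power_one hx]
  rw [hsSq_sub, hsSq_sub, hsSq_mul_of_isometry W hV, hroot hsp, hroot hwp, hPt,
    conjTranspose_power, Matrix.trace_mul_comm (power w _), hkey, hsSq_eq_re_trace W,
    hsSq_eq_re_trace N, ← hs, ← hw]
  linarith

/-- If `T * Tᴴ` is close to the identity as seen through `N`, then `N * T` can be mapped back to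
`N` by an isometry. The deviation is measured after conjugation by `N` normalized with
`(N * Nᴴ) ^ (-1 / 4)`; this is the normalization that occurs in the collision entropy. -/
lemma exists_isometry_hsSq_sub_le_of_decoupled [DecidableEq b] [DecidableEq a] [DecidableEq g]
    (hag : Fintype.card a ≤ Fintype.card g) (N : Matrix b g ℂ) (T : Matrix g a ℂ)
    {μ : ℝ} (hμ : 0 < μ) :
    ∃ V : Matrix g a ℂ, Vᴴ * V = 1 ∧ hsSq (N * T * Vᴴ - N) ≤
      (μ * hsSq N + μ⁻¹ * hsSq (power (N * Nᴴ) (-(1 / 4)) * N * (T * Tᴴ - 1) *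
        (power (N * Nᴴ) (-(1 / 4)) * N)ᴴ)) / 2 := by
  obtain ⟨V, hV, hle⟩ := exists_isometry_hsSq_sub_le hag N (N * T)
  refine ⟨V, hV, hle.trans ?_⟩
  set w := N * Nᴴ with hw
  set s := N * T * (N * T)ᴴ with hs
  have hsp : s.PosSemidef := Matrix.posSemidef_self_mul_conjTranspose _
  have hwp : w.PosSemidef := Matrix.posSemidef_self_mul_conjTranspose N
  obtain ⟨S, hSh, hSc, hS⟩ := exists_sign_hsSq_sub_le (posSemidef_power hsp (1 / 2))
    (posSemidef_power hwp (1 / 2))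
  refine hS.trans ?_
  rw [power_mul_power hsp (by norm_num), power_mul_power hwp (by norm_num),
    show (1 / 2 : ℝ) + 1 / 2 = 1 by norm_num, power_one hsp, power_one hwp]
  set p := power w (-(1 / 4)) with hp
  set q := power w (1 / 4) with hq
  have hqp : q * p = supportProj w := power_mul_power_neg hwp (by norm_num)
  have hpq : p * q = supportProj w := by
    rw [hp, hq]
    have := power_mul_power_neg hwp (s := -(1 / 4)) (by norm_num)
    rwa [neg_neg, ← hp, ← hq] at this
  have hph : pᴴ = p := conjTranspose_power _ _
  have hqh : qᴴ = q := conjTranspose_power _ _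
  have hN : supportProj w * N = N := supportProj_mul_of_self_mul_conjTranspose N
  have hN' : Nᴴ * supportProj w = Nᴴ := by
    have := congrArg Matrix.conjTranspose hN
    rwa [Matrix.conjTranspose_mul, supportProj, conjTranspose_cfc, ← supportProj] at this
  set E := T * Tᴴ - 1 with hE
  have hD : s - w = N * E * Nᴴ := by
    rw [hs, hw, hE, Matrix.mul_sub, Matrix.sub_mul, Matrix.mul_one, Matrix.conjTranspose_mul]
    simp only [Matrix.mul_assoc]
  have htr : ((s - w) * S).trace = ((q * S * q)ᴴ * (p * N * E * (p * N)ᴴ)).trace := by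
    have h1 : (q * S * q)ᴴ * (p * N * E * (p * N)ᴴ) = q * (S * ((q * p * N) * (E * (Nᴴ * p)))) := by
      simp only [Matrix.conjTranspose_mul, hph, hqh, hSh, Matrix.mul_assoc]
    rw [hD, h1, hqp, hN, Matrix.trace_mul_comm q,
      show S * (N * (E * (Nᴴ * p))) * q = S * (N * (E * (Nᴴ * (p * q)))) by
        simp only [Matrix.mul_assoc], hpq, hN', Matrix.trace_mul_comm S]
    simp only [Matrix.mul_assoc]
  have h1 := two_re_trace_le (p * N * E * (p * N)ᴴ) (q * S * q) (inv_pos.2 hμ)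
  rw [← htr, inv_inv] at h1
  -- Cauchy-Schwarz reduces the left side to `tr (w * S²)`, and `S² ≤ 1`.
  have h2 : hsSq (q * S * q) ≤ hsSq N := by
    set u := power w (1 / 2) with hu
    have huh : uᴴ = u := conjTranspose_power _ _
    have hqq : q * q = u := by rw [hq, power_mul_power hwp (by norm_num), hu]; norm_num
    have huu : u * u = w := by
      rw [hu, power_mul_power hwp (by norm_num), show (1 / 2 : ℝ) + 1 / 2 = 1 by norm_num,
        power_one hwp]
    clear_value u q
    have e1 : hsSq (q * S * q) = ((S * u)ᴴ * (u * S)).trace.re := by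
      rw [hsSq_eq_re_trace, Matrix.conjTranspose_mul, Matrix.conjTranspose_mul, hqh, hSh,
        show q * S * q * (q * (S * q)) = q * (S * (q * q) * S * q) by
          simp only [Matrix.mul_assoc], Matrix.trace_mul_comm, hqq,
        show S * u * S * q * q = S * u * S * (q * q) by simp only [Matrix.mul_assoc], hqq,
        Matrix.conjTranspose_mul, huh, hSh, Matrix.mul_assoc, Matrix.trace_mul_comm]
      simp only [Matrix.mul_assoc]
      rw [Matrix.trace_mul_comm]
      simp only [Matrix.mul_assoc]
    have e2 : hsSq (u * S) = (w * (S * S)).trace.re := by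
      rw [hsSq_eq_re_trace', Matrix.conjTranspose_mul, huh, hSh,
        show S * u * (u * S) = S * (u * u * S) by simp only [Matrix.mul_assoc], huu,
        Matrix.trace_mul_comm, Matrix.mul_assoc]
    have e3 : hsSq (S * u) = (w * (S * S)).trace.re := by
      rw [hsSq_eq_re_trace', Matrix.conjTranspose_mul, huh, hSh,
        show u * S * (S * u) = u * (S * S * u) by simp only [Matrix.mul_assoc],
        Matrix.trace_mul_comm, Matrix.mul_assoc, huu, Matrix.trace_mul_comm]
    have e4 := two_re_trace_le (u * S) (S * u) one_pos
    have e5 := re_trace_mul_nonneg hwp hSc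
    rw [Matrix.mul_sub, Matrix.mul_one, Matrix.trace_sub, Complex.sub_re] at e5
    rw [e1, hsSq_eq_re_trace N, ← hw]
    rw [e2, e3] at e4
    linarith
  have h3 := mul_le_mul_of_nonneg_left h2 hμ.le
  linarith

end Uhlmann

/-! ### Trace norm and the compact set of isometries -/

section TraceNorm

/-- The square of the Euclidean norm of a vector. -/
def nSq {n : Type*} [Fintype n] (y : n → ℂ) : ℝ := ∑ i, ‖y i‖ ^ 2

lemma nSq_nonneg {n : Type*} [Fintype n] (y : n → ℂ) : 0 ≤ nSq y :=
  Finset.sum_nonneg fun _ _ => sq_nonneg _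

lemma hsSq_vecMulVec {m n : Type*} [Fintype m] [Fintype n] (x : m → ℂ) (y : n → ℂ) :
    hsSq (Matrix.vecMulVec x (star y)) = nSq x * nSq y := by
  simp [hsSq, nSq, Matrix.vecMulVec_apply, mul_pow, Finset.sum_mul_sum]

variable {m n : Type*} [Fintype m] [Fintype n] [DecidableEq n]

lemma traceNorm_nonneg (M : Matrix m n ℂ) : 0 ≤ traceNorm M :=
  Finset.sum_nonneg fun _ _ => Real.sqrt_nonneg _

lemma traceNorm_sq_le (M : Matrix m n ℂ) : traceNorm M ^ 2 ≤ M.rank * hsSq M := by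
  classical
  have hH := Matrix.posSemidef_conjTranspose_mul_self M
  set l : n → ℝ := (Matrix.isHermitian_conjTranspose_mul_self M).eigenvalues with hl
  have hl0 : ∀ i, 0 ≤ l i := hH.eigenvalues_nonneg
  set s := Finset.univ.filter fun i => l i ≠ 0 with hs
  have h1 : traceNorm M = ∑ i ∈ s, √(l i) := by
    rw [traceNorm, hs, Finset.sum_filter]
    refine Finset.sum_congr rfl fun i _ => ?_
    by_cases h : l i = 0
    · rw [if_neg (not_not.2 h), ← hl, h, Real.sqrt_zero]
    · rw [if_pos h]
  have h2 : (s.card : ℝ) = M.rank := by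
    rw [← Matrix.rank_conjTranspose_mul_self M,
      (Matrix.isHermitian_conjTranspose_mul_self M).rank_eq_card_non_zero_eigs,
      Fintype.card_subtype]
  have h3 : hsSq M = ∑ i ∈ s, √(l i) ^ 2 := by
    rw [hsSq_eq_re_trace', (Matrix.isHermitian_conjTranspose_mul_self M).trace_eq_sum_eigenvalues,
      Complex.re_sum, hs, Finset.sum_filter]
    refine Finset.sum_congr rfl fun i _ => ?_
    rw [Real.sq_sqrt (hl0 i)]
    by_cases h : l i = 0
    · rw [if_neg (not_not.2 h), ← hl, h]; simp
    · rw [if_pos h]; simp [hl]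
  rw [h1, ← h2, h3]
  exact sq_sum_le_card_mul_sum_sq

/-- The trace distance of two rank-one operators in terms of the distance of the vectors, with a
free weight `c`, in a form that is affine in the squared norms and hence suited to taking
expectations. -/
lemma traceNorm_pureState_sub_le (y v : n → ℂ) {c : ℝ} (hc : 0 < c) :
    traceNorm (pureState y - pureState v) ≤ c * (nSq y + nSq v) + c⁻¹ * nSq (y - v) := by
  set M := pureState y - pureState v with hM
  have hrank : (M.rank : ℝ) ≤ 2 := by
    have h : M = (Matrix.of fun i (k : Fin 2) => ![y i, v i] k) *
        (Matrix.of fun (k : Fin 2) i => ![star (y i), -star (v i)] k) := by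
      ext i j
      simp [hM, pureState, Matrix.mul_apply, Matrix.vecMulVec_apply, sub_eq_add_neg]
    have : M.rank ≤ 2 := by
      rw [h]
      exact (Matrix.rank_mul_le_left _ _).trans ((Matrix.rank_le_card_width _).trans (by simp))
    exact_mod_cast this
  have hhs : hsSq M ≤ 2 * (nSq (y - v) * (nSq y + nSq v)) := by
    have h : M = Matrix.vecMulVec y (star (y - v)) + Matrix.vecMulVec (y - v) (star v) := by
      rw [hM, pureState, pureState, star_sub, Matrix.vecMulVec_sub, Matrix.sub_vecMulVec]
      abel
    rw [h]
    refine (hsSq_add_le _ _).trans (le_of_eq ?_)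
    rw [hsSq_vecMulVec, hsSq_vecMulVec]; ring
  have h0 := nSq_nonneg (y - v)
  have h1 := add_nonneg (nSq_nonneg y) (nSq_nonneg v)
  set X := nSq (y - v)
  set Y := nSq y + nSq v
  have h2 : traceNorm M ^ 2 ≤ (c * Y + c⁻¹ * X) ^ 2 := by
    have h3 : traceNorm M ^ 2 ≤ 2 * (2 * (X * Y)) :=
      (traceNorm_sq_le M).trans (mul_le_mul hrank hhs (hsSq_nonneg _) (by norm_num))
    have h4 : (c * Y + c⁻¹ * X) ^ 2 = (c * Y - c⁻¹ * X) ^ 2 + 4 * (X * Y) := by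
      field_simp; ring
    nlinarith [sq_nonneg (c * Y - c⁻¹ * X)]
  have hci := inv_pos.2 hc
  exact (pow_le_pow_iff_left₀ (traceNorm_nonneg M) (by positivity) two_ne_zero).1 h2

section
open scoped Matrix.Norms.L2Operator

lemma continuous_traceNorm : Continuous fun M : Matrix m n ℂ => traceNorm M := by
  have h : ∀ M : Matrix m n ℂ, traceNorm M = (cfc Real.sqrt (Mᴴ * M)).trace.re := by
    intro M
    have hH := Matrix.isHermitian_conjTranspose_mul_self M
    rw [hH.cfc_eq, Matrix.IsHermitian.cfc, Unitary.conjStarAlgAut_apply,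
      Matrix.trace_mul_comm, ← Matrix.mul_assoc, Unitary.coe_star_mul_self, Matrix.one_mul,
      Matrix.trace_diagonal, Complex.re_sum]
    rfl
  have hc : Continuous fun M : Matrix m n ℂ => cfc Real.sqrt (Mᴴ * M) :=
    Continuous.cfc_of_mem_nhdsSet (s := Set.univ) Real.sqrt Filter.univ_mem
      (by fun_prop) (fun M => Matrix.isHermitian_conjTranspose_mul_self M)
      Real.continuous_sqrt.continuousOn
  simp_rw [h]
  exact Complex.continuous_re.comp (Continuous.matrix_trace hc)

end

lemma isCompact_setOf_isIsometry : IsCompact {V : Matrix m n ℂ | IsIsometry V} := by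
  have hb : IsCompact (Set.univ.pi fun _ : m => Set.univ.pi fun _ : n =>
      Metric.closedBall (0 : ℂ) 1) :=
    isCompact_univ_pi fun _ => isCompact_univ_pi fun _ => isCompact_closedBall 0 1
  have hc : IsClosed {V : Matrix m n ℂ | IsIsometry V} := by
    have : Continuous fun V : Matrix m n ℂ => Vᴴ * V := by fun_prop
    exact isClosed_eq this continuous_const
  refine hb.of_isClosed_subset hc fun (V : Matrix m n ℂ) hV i _ j _ => ?_
  have h1 : ∑ k, ‖V k j‖ ^ 2 = 1 := by
    have h := congrArg (fun W : Matrix n n ℂ => (W j j).re) (show Vᴴ * V = 1 from hV)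
    rw [Matrix.mul_apply, Matrix.one_apply_eq, Complex.re_sum, Complex.one_re] at h
    rw [← h]
    refine Finset.sum_congr rfl fun k _ => ?_
    rw [Matrix.conjTranspose_apply, RCLike.star_def, mul_comm, Complex.mul_conj,
      Complex.ofReal_re, Complex.normSq_eq_norm_sq]
  have h2 : ‖V i j‖ ^ 2 ≤ 1 := by
    rw [← h1]
    exact Finset.single_le_sum (f := fun k => ‖V k j‖ ^ 2) (fun _ _ => sq_nonneg _)
      (Finset.mem_univ i)
  rw [mem_closedBall_zero_iff]
  exact (sq_le_one_iff₀ (norm_nonneg _)).1 h2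

lemma exists_isIsometry {m n : Type*} [Fintype m] [Fintype n] [DecidableEq n] [DecidableEq m]
    (h : Fintype.card n ≤ Fintype.card m) : ∃ V : Matrix m n ℂ, IsIsometry V :=
  let ⟨V, _, hV, _⟩ := exists_polar h (0 : Matrix m n ℂ)
  ⟨V, hV⟩

end TraceNorm

/-! ### Moments of the standard complex Gaussian -/

section Gaussian

local notation "γ" => stdComplexGaussian
local notation "conj" => starRingEnd ℂ

lemma integral_sq_gaussianReal : ∫ x, x ^ 2 ∂gaussianReal 0 1 = 1 := by
  have h := variance_fun_id_gaussianReal (μ := 0) (v := 1)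
  rw [variance_eq_integral measurable_id'.aemeasurable] at h
  simpa using h

/-- The fourth moment is read off from the fourth derivative of the moment generating function
`exp (t ^ 2 / 2)`, each derivative of which is a polynomial times `exp (t ^ 2 / 2)`. -/
lemma integral_pow_four_gaussianReal : ∫ x, x ^ 4 ∂gaussianReal 0 1 = 3 := by
  have h0 : ∫ x, x ^ 4 ∂gaussianReal 0 1 =
      iteratedDeriv 4 (mgf (fun x ↦ x) (gaussianReal 0 1)) 0 := by
    rw [iteratedDeriv_mgf_zero] <;> simp
  have hd : ∀ (p q : ℝ → ℝ), (∀ t, HasDerivAt p (q t - t * p t) t) →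
      deriv (fun t => p t * Real.exp (t ^ 2 / 2)) = fun t => q t * Real.exp (t ^ 2 / 2) := by
    intro p q h
    ext t
    have h1 : HasDerivAt (fun t : ℝ => Real.exp (t ^ 2 / 2)) (Real.exp (t ^ 2 / 2) * t) t := by
      have : HasDerivAt (fun t : ℝ => t ^ 2 / 2) t t := by
        simpa using (hasDerivAt_pow 2 t).div_const 2
      exact this.exp
    rw [((h t).fun_mul h1).deriv]
    ring
  rw [h0, mgf_fun_id_gaussianReal]
  have e0 : (fun t : ℝ => Real.exp (0 * t + ((1 : NNReal) : ℝ) * t ^ 2 / 2)) =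
      fun t => (fun _ => 1 : ℝ → ℝ) t * Real.exp (t ^ 2 / 2) := by ext t; simp
  rw [e0, iteratedDeriv_eq_iterate]
  simp only [Function.iterate_succ, Function.iterate_zero, Function.comp_apply, id_eq]
  rw [hd (fun _ => 1) (fun t => t), hd (fun t => t) (fun t => t ^ 2 + 1),
    hd (fun t => t ^ 2 + 1) (fun t => t ^ 3 + 3 * t),
    hd (fun t => t ^ 3 + 3 * t) (fun t => t ^ 4 + 6 * t ^ 2 + 3)]
  · simp
  · exact fun t => ((hasDerivAt_pow 3 t).fun_add ((hasDerivAt_id' t).const_mul 3)).congr_deriv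
      (by push_cast; ring)
  · exact fun t => ((hasDerivAt_pow 2 t).add_const (1 : ℝ)).congr_deriv (by push_cast; ring)
  · exact fun t => (hasDerivAt_id' t).congr_deriv (by ring)
  · exact fun t => (hasDerivAt_const t (1 : ℝ)).congr_deriv (by ring)

lemma integrable_pow_gaussianReal (k : ℕ) : Integrable (fun x : ℝ => x ^ k) (gaussianReal 0 1) := by
  have h := (memLp_id_gaussianReal' (μ := 0) (v := 1) (k : ENNReal) (by simp)).integrable_norm_pow'
  have h2 : Integrable (fun x : ℝ => ‖x ^ k‖) (gaussianReal 0 1) := by simpa using h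
  exact (integrable_norm_iff (by fun_prop)).1 h2

/-- The map `(x, y) ↦ (x + i y) / √2` that defines the standard complex Gaussian. -/
def gaussCoord (p : ℝ × ℝ) : ℂ := ((p.1 : ℂ) + Complex.I * (p.2 : ℂ)) / ((Real.sqrt 2 : ℝ) : ℂ)

lemma measurable_gaussCoord : Measurable gaussCoord := by unfold gaussCoord; fun_prop

lemma stdComplexGaussian_eq_map :
    γ = ((gaussianReal 0 1).prod (gaussianReal 0 1)).map gaussCoord := rfl

lemma normSq_gaussCoord (p : ℝ × ℝ) : ‖gaussCoord p‖ ^ 2 = (p.1 ^ 2 + p.2 ^ 2) / 2 := by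
  rw [← Complex.normSq_eq_norm_sq, gaussCoord, Complex.normSq_div, Complex.normSq_ofReal]
  rw [Real.mul_self_sqrt (by norm_num)]
  congr 1
  rw [mul_comm, Complex.normSq_add_mul_I]

lemma integrable_norm_pow_stdComplexGaussian (k : ℕ) :
    Integrable (fun z : ℂ => ‖z‖ ^ (2 * k)) γ := by
  rw [stdComplexGaussian_eq_map, integrable_map_measure (by fun_prop)
    measurable_gaussCoord.aemeasurable]
  have : (fun z : ℂ => ‖z‖ ^ (2 * k)) ∘ gaussCoord =
      fun p => ∑ m ∈ Finset.range (k + 1), (p.1 ^ (2 * m) * p.2 ^ (2 * (k - m))) *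
        ((k.choose m : ℝ) / 2 ^ k) := by
    ext p
    rw [Function.comp_apply, pow_mul, normSq_gaussCoord, div_pow, add_pow, Finset.sum_div]
    refine Finset.sum_congr rfl fun m _ => ?_
    rw [← pow_mul, ← pow_mul]; ring
  rw [this]
  exact integrable_finsetSum _ fun m _ => (Integrable.mul_prod
    (integrable_pow_gaussianReal (2 * m)) (integrable_pow_gaussianReal (2 * (k - m)))).mul_const _

lemma integrable_monomial_stdComplexGaussian (a b : ℕ) :
    Integrable (fun z : ℂ => z ^ a * conj z ^ b) γ := by
  have h : Integrable (fun z : ℂ => 1 + ‖z‖ ^ (2 * (a + b))) γ :=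
    (integrable_const _).add (integrable_norm_pow_stdComplexGaussian _)
  refine h.mono' (by fun_prop) (Filter.Eventually.of_forall fun z => ?_)
  rw [norm_mul, norm_pow, norm_pow, RCLike.norm_conj, ← pow_add, mul_comm 2, pow_mul]
  nlinarith [sq_nonneg (‖z‖ ^ (a + b) - 1), sq_nonneg (‖z‖ ^ (a + b))]

lemma integral_norm_sq_stdComplexGaussian : ∫ z, ‖z‖ ^ 2 ∂γ = 1 := by
  rw [stdComplexGaussian_eq_map, integral_map measurable_gaussCoord.aemeasurable (by fun_prop)]
  simp_rw [normSq_gaussCoord, add_div]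
  have h1 : Integrable (fun p : ℝ × ℝ => p.1 ^ 2 / 2)
      ((gaussianReal 0 1).prod (gaussianReal 0 1)) :=
    ((integrable_pow_gaussianReal 2).div_const 2).comp_fst _
  have h2 : Integrable (fun p : ℝ × ℝ => p.2 ^ 2 / 2)
      ((gaussianReal 0 1).prod (gaussianReal 0 1)) :=
    ((integrable_pow_gaussianReal 2).div_const 2).comp_snd _
  rw [integral_add h1 h2, integral_fun_fst (fun x : ℝ => x ^ 2 / 2),
    integral_fun_snd (fun x : ℝ => x ^ 2 / 2), integral_div, integral_sq_gaussianReal]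
  simp; norm_num

lemma integral_norm_pow_four_stdComplexGaussian : ∫ z, ‖z‖ ^ 4 ∂γ = 2 := by
  rw [stdComplexGaussian_eq_map, integral_map measurable_gaussCoord.aemeasurable (by fun_prop)]
  have e : ∀ p : ℝ × ℝ, ‖gaussCoord p‖ ^ 4 =
      p.1 ^ 4 / 4 + p.2 ^ 4 / 4 + p.1 ^ 2 * (p.2 ^ 2 / 2) := by
    intro p
    rw [show 4 = 2 * 2 from rfl, pow_mul, normSq_gaussCoord]; ring
  simp_rw [e]
  have h1 : Integrable (fun p : ℝ × ℝ => p.1 ^ 4 / 4)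
      ((gaussianReal 0 1).prod (gaussianReal 0 1)) :=
    ((integrable_pow_gaussianReal 4).div_const 4).comp_fst _
  have h2 : Integrable (fun p : ℝ × ℝ => p.2 ^ 4 / 4)
      ((gaussianReal 0 1).prod (gaussianReal 0 1)) :=
    ((integrable_pow_gaussianReal 4).div_const 4).comp_snd _
  have h3 : Integrable (fun p : ℝ × ℝ => p.1 ^ 2 * (p.2 ^ 2 / 2))
      ((gaussianReal 0 1).prod (gaussianReal 0 1)) :=
    (integrable_pow_gaussianReal 2).mul_prod ((integrable_pow_gaussianReal 2).div_const 2)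
  rw [integral_add (by exact h1.add h2) h3, integral_add h1 h2,
    integral_fun_fst (fun x : ℝ => x ^ 4 / 4), integral_fun_snd (fun x : ℝ => x ^ 4 / 4),
    integral_prod_mul (fun x : ℝ => x ^ 2) (fun x : ℝ => x ^ 2 / 2), integral_div, integral_div,
    integral_sq_gaussianReal, integral_pow_four_gaussianReal]
  simp; norm_num

/-- Circular symmetry under a quarter turn, which is all that is needed to see that the unbalanced
monomials of degree at most two in `z` and in `conj z` have mean zero. -/
lemma measurePreserving_I_mul : MeasurePreserving (fun z : ℂ => Complex.I * z) γ γ := by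
  refine ⟨by fun_prop, ?_⟩
  have h1 : MeasurePreserving (fun x : ℝ => -x) (gaussianReal 0 1) (gaussianReal 0 1) :=
    ⟨by fun_prop, by rw [gaussianReal_map_neg, neg_zero]⟩
  have h2 := (h1.prod (MeasurePreserving.id (gaussianReal 0 1))).comp
    (Measure.measurePreserving_swap (μ := gaussianReal 0 1) (ν := gaussianReal 0 1))
  conv_rhs => rw [stdComplexGaussian_eq_map, ← h2.map_eq]
  rw [stdComplexGaussian_eq_map, Measure.map_map (by fun_prop) measurable_gaussCoord,
    Measure.map_map measurable_gaussCoord (by fun_prop)]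
  congr 1
  ext p
  simp only [Function.comp_apply, gaussCoord, Prod.map, Prod.swap, id_eq]
  rw [← mul_div_assoc, mul_add, ← mul_assoc, Complex.I_mul_I]
  push_cast; ring_nf

lemma integral_monomial_stdComplexGaussian {a b : ℕ} (ha : a ≤ 2) (hb : b ≤ 2) :
    ∫ z, z ^ a * conj z ^ b ∂γ = if a = b then (a.factorial : ℂ) else 0 := by
  by_cases hab : a = b
  · subst hab
    have h : ∀ z : ℂ, z ^ a * conj z ^ a = ((‖z‖ ^ (2 * a) : ℝ) : ℂ) := by
      intro z
      rw [← mul_pow, Complex.mul_conj, Complex.normSq_eq_norm_sq, pow_mul]; push_cast; rfl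
    simp_rw [h, if_true]
    rw [integral_complex_ofReal]
    interval_cases a
    · simp
    · simp [integral_norm_sq_stdComplexGaussian]
    · simp [integral_norm_pow_four_stdComplexGaussian]
  · rw [if_neg hab]
    have h := measurePreserving_I_mul.integral_comp
      (Homeomorph.mulLeft₀ Complex.I Complex.I_ne_zero).measurableEmbedding
      (fun z => z ^ a * conj z ^ b)
    have e : ∀ z : ℂ, (Complex.I * z) ^ a * conj (Complex.I * z) ^ b =
        (Complex.I ^ a * (-Complex.I) ^ b) * (z ^ a * conj z ^ b) := by
      intro z
      rw [map_mul, Complex.conj_I]; ring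
    simp_rw [e] at h
    rw [integral_const_mul] at h
    have h2 : Complex.I ^ a * (-Complex.I) ^ b ≠ 1 := by
      interval_cases a <;> interval_cases b <;> simp_all <;> norm_num [Complex.ext_iff]
    have h3 : (Complex.I ^ a * (-Complex.I) ^ b - 1) * ∫ z, z ^ a * conj z ^ b ∂γ = 0 := by
      rw [sub_mul, h]; ring
    exact (mul_eq_zero.1 h3).resolve_left (sub_ne_zero.2 h2)

end Gaussian

/-! ### Second and fourth moments of a random tensor -/

section VertexMoments

local notation "γ" => stdComplexGaussian
local notation "conj" => starRingEnd ℂ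

variable {I : Type*} [Fintype I]

/-- The law of one random tensor, a vector of independent standard complex Gaussians. -/
def vectorLaw (I : Type*) [Fintype I] : Measure (I → ℂ) := Measure.pi fun _ => γ

instance : IsProbabilityMeasure (vectorLaw I) := by unfold vectorLaw; infer_instance

lemma integrable_monomial_vectorLaw (a b : I → ℕ) :
    Integrable (fun z : I → ℂ => ∏ i, (z i ^ a i * conj (z i) ^ b i)) (vectorLaw I) :=
  Integrable.fintype_prod_dep (f := fun i (z : ℂ) => z ^ a i * conj z ^ b i)
    fun i => integrable_monomial_stdComplexGaussian (a i) (b i)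

lemma integral_monomial_vectorLaw {a b : I → ℕ} (ha : ∀ i, a i ≤ 2) (hb : ∀ i, b i ≤ 2) :
    ∫ z, ∏ i, (z i ^ a i * conj (z i) ^ b i) ∂vectorLaw I =
      ∏ i, if a i = b i then ((a i).factorial : ℂ) else 0 := by
  rw [vectorLaw, integral_fintype_prod_eq_prod (fun i (z : ℂ) => z ^ a i * conj z ^ b i)]
  exact Finset.prod_congr rfl fun i _ => integral_monomial_stdComplexGaussian (ha i) (hb i)

variable [DecidableEq I]

lemma conj_mul_eq_monomial (i j : I) (z : I → ℂ) : conj (z i) * z j =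
    ∏ k, (z k ^ (if j = k then 1 else 0) * conj (z k) ^ (if i = k then 1 else 0)) := by
  rw [Finset.prod_mul_distrib, Finset.prod_pow_boole,
    Finset.prod_pow_boole]
  simp [mul_comm]

lemma conj_mul_mul_conj_eq_monomial (g g' h h' : I) (z : I → ℂ) :
    conj (z g) * z g' * conj (conj (z h) * z h') =
    ∏ k, (z k ^ ((if g' = k then 1 else 0) + (if h = k then 1 else 0)) *
      conj (z k) ^ ((if g = k then 1 else 0) + (if h' = k then 1 else 0))) := by
  simp_rw [pow_add]
  rw [Finset.prod_mul_distrib, Finset.prod_mul_distrib, Finset.prod_mul_distrib,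
    Finset.prod_pow_boole, Finset.prod_pow_boole, Finset.prod_pow_boole, Finset.prod_pow_boole]
  simp
  ring

lemma integrable_conj_mul (i j : I) :
    Integrable (fun z : I → ℂ => conj (z i) * z j) (vectorLaw I) := by
  simp_rw [conj_mul_eq_monomial]
  exact integrable_monomial_vectorLaw _ _

lemma integrable_conj_mul_mul_conj (g g' h h' : I) :
    Integrable (fun z : I → ℂ => conj (z g) * z g' * conj (conj (z h) * z h')) (vectorLaw I) := by
  simp_rw [conj_mul_mul_conj_eq_monomial]
  exact integrable_monomial_vectorLaw _ _

lemma integral_conj_mul (i j : I) :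
    ∫ z, conj (z i) * z j ∂vectorLaw I = if i = j then 1 else 0 := by
  simp_rw [conj_mul_eq_monomial]
  rw [integral_monomial_vectorLaw (fun k => by split_ifs <;> simp) (fun k => by split_ifs <;> simp)]
  by_cases hij : i = j
  · subst hij
    rw [if_pos rfl]
    refine Finset.prod_eq_one fun k _ => ?_
    split_ifs <;> simp_all
  · rw [if_neg hij]
    refine Finset.prod_eq_zero (Finset.mem_univ i) ?_
    simp [Ne.symm hij]

/-- Wick's formula for the fourth moments of a vector of independent standard complex Gaussians. -/
lemma integral_conj_mul_mul_conj (g g' h h' : I) :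
    ∫ z, conj (z g) * z g' * conj (conj (z h) * z h') ∂vectorLaw I =
      (if g = g' then 1 else 0) * (if h = h' then 1 else 0) +
      (if g = h then 1 else 0) * (if g' = h' then 1 else 0) := by
  simp_rw [conj_mul_mul_conj_eq_monomial]
  rw [integral_monomial_vectorLaw (fun k => by split_ifs <;> simp) (fun k => by split_ifs <;> simp)]
  by_cases h1 : g = g'
  · subst h1
    by_cases h2 : h = h'
    · subst h2
      by_cases h3 : g = h
      · subst h3
        rw [Finset.prod_eq_single g]
        · norm_num
        · intro k _ hk; simp [Ne.symm hk]
        · simp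
      · rw [Finset.prod_eq_one]
        · simp [h3]
        · intro k _
          by_cases h4 : g = k
          · subst h4; simp [Ne.symm h3]
          · by_cases h5 : h = k <;> simp [h4, h5]
    · rw [Finset.prod_eq_zero (Finset.mem_univ h)]
      · by_cases h3 : g = h
        · subst h3; simp [h2]
        · simp [h2, h3]
      · simp [Ne.symm h2]
  · by_cases h2 : g = h
    · subst h2
      by_cases h3 : g' = h'
      · subst h3
        rw [Finset.prod_eq_one]
        · simp [h1]
        · intro k _
          by_cases h4 : g = k
          · subst h4; simp [Ne.symm h1]
          · by_cases h5 : g' = k <;> simp [h4, h5]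
      · rw [Finset.prod_eq_zero (Finset.mem_univ g')]
        · simp [h1, h3]
        · simp [h1, Ne.symm h3]
    · rw [Finset.prod_eq_zero (Finset.mem_univ g)]
      · simp [h1, h2]
      · simp only [Ne.symm h1, Ne.symm h2, if_false, if_true]
        rw [if_neg (by omega)]

end VertexMoments

/-! ### Second moments of the fluctuations of an isotropic random matrix -/

section Decoupling

variable {Ω : Type*} [MeasurableSpace Ω] {P : Measure Ω} [IsProbabilityMeasure P]
variable {g a b σ τ : Type*} [Fintype g] [Fintype a] [Fintype b] [Fintype σ] [Fintype τ]

lemma mul_mul_conjTranspose_apply (X : Matrix b g ℂ) (T : Matrix g g ℂ) (k k' : b) :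
    (X * T * Xᴴ) k k' = ∑ p : g × g, X k p.1 * star (X k' p.2) * T p.1 p.2 := by
  rw [Fintype.sum_prod_type_right, Matrix.mul_apply]
  refine Finset.sum_congr rfl fun j _ => ?_
  rw [Matrix.mul_apply, Finset.sum_mul]
  refine Finset.sum_congr rfl fun i _ => ?_
  rw [Matrix.conjTranspose_apply]; ring

/-- A random matrix with `𝔼 T Tᴴ = 1` preserves the Hilbert-Schmidt norm in the mean. -/
lemma integral_hsSq_mul [DecidableEq g] {T : Ω → Matrix g a ℂ}
    (hint : ∀ i j, Integrable (fun t => (T t * (T t)ᴴ) i j) P)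
    (hmean : ∀ i j, ∫ t, (T t * (T t)ᴴ) i j ∂P = (1 : Matrix g g ℂ) i j) (X : Matrix b g ℂ) :
    Integrable (fun t => hsSq (X * T t)) P ∧ ∫ t, hsSq (X * T t) ∂P = hsSq X := by
  have h : ∀ t, ((hsSq (X * T t) : ℝ) : ℂ) =
      ∑ k, ∑ p : g × g, X k p.1 * star (X k p.2) * (T t * (T t)ᴴ) p.1 p.2 := by
    intro t
    rw [← trace_mul_conjTranspose_self, Matrix.conjTranspose_mul, Matrix.trace,
      show X * T t * ((T t)ᴴ * Xᴴ) = X * (T t * (T t)ᴴ) * Xᴴ by simp only [Matrix.mul_assoc]]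
    exact Finset.sum_congr rfl fun k _ => mul_mul_conjTranspose_apply _ _ _ _
  have hi : ∀ k (p : g × g),
      Integrable (fun t => X k p.1 * star (X k p.2) * (T t * (T t)ᴴ) p.1 p.2) P :=
    fun k p => (hint p.1 p.2).const_mul _
  have hI : Integrable (fun t => ((hsSq (X * T t) : ℝ) : ℂ)) P := by
    simp_rw [h]
    exact integrable_finsetSum _ fun k _ => integrable_finsetSum _ fun p _ => hi k p
  refine ⟨by simpa using hI.re, ?_⟩
  have h2 : ((∫ t, hsSq (X * T t) ∂P : ℝ) : ℂ) = (hsSq X : ℂ) := by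
    rw [← integral_complex_ofReal]
    simp_rw [h]
    rw [integral_finsetSum _ fun k _ => integrable_finsetSum _ fun p _ => hi k p]
    rw [← trace_mul_conjTranspose_self, Matrix.trace]
    refine Finset.sum_congr rfl fun k _ => ?_
    rw [integral_finsetSum _ fun p _ => hi k p, Matrix.diag_apply,
      show X * Xᴴ = X * (1 : Matrix g g ℂ) * Xᴴ by rw [Matrix.mul_one],
      mul_mul_conjTranspose_apply]
    refine Finset.sum_congr rfl fun p _ => ?_
    rw [integral_const_mul, hmean]
  exact_mod_cast h2

/-- The matrix `N` with the factor `σ` of a tensor factorization `g ≃ σ × τ` of its column space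
moved to the rows. -/
def regroup (e : σ × τ ≃ g) (N : Matrix b g ℂ) : Matrix (σ × b) τ ℂ :=
  fun p c => N p.2 (e (p.1, c))

/-- For a tensor factorization `g ≃ σ × τ`, the coefficient of the pairing that contracts the `σ`
parts of the indices across the two copies of `T * Tᴴ` and the `τ` parts within each copy. -/
def swapWeight [DecidableEq σ] [DecidableEq τ] (e : σ × τ ≃ g) (p q : g × g) : ℂ :=
  if ((e.symm p.1).1 = (e.symm q.1).1 ∧ (e.symm p.2).1 = (e.symm q.2).1) ∧
    ((e.symm p.1).2 = (e.symm p.2).2 ∧ (e.symm q.1).2 = (e.symm q.2).2) then 1 else 0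

lemma sum_swapWeight [DecidableEq σ] [DecidableEq τ] (e : σ × τ ≃ g) (F : g → g → ℂ) :
    ∑ p : g × g, ∑ q : g × g, F p.1 p.2 * star (F q.1 q.2) * swapWeight e p q =
    ((∑ s, ∑ s', ‖∑ c, F (e (s, c)) (e (s', c))‖ ^ 2 : ℝ) : ℂ) := by
  have hsum : ∀ f : g × g → ℂ, ∑ p : g × g, f p =
      ∑ s, ∑ s', ∑ c, ∑ c', f (e (s, c), e (s', c')) := by
    intro f
    rw [Fintype.sum_prod_type, ← e.sum_comp, Fintype.sum_prod_type]
    refine Finset.sum_congr rfl fun s _ => ?_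
    refine Eq.trans (Finset.sum_congr rfl fun c _ => ?_) Finset.sum_comm
    rw [← e.sum_comp, Fintype.sum_prod_type]
  have hin : ∀ s s' c c', ∑ q : g × g, F (e (s, c)) (e (s', c')) * star (F q.1 q.2) *
      swapWeight e (e (s, c), e (s', c')) q =
      if c = c' then F (e (s, c)) (e (s', c')) * ∑ d, star (F (e (s, d)) (e (s', d))) else 0 := by
    intro s s' c c'
    rw [hsum, Fintype.sum_eq_single s, Fintype.sum_eq_single s']
    · by_cases h : c = c'
      · simp only [swapWeight, Equiv.symm_apply_apply, h, true_and, mul_ite, mul_one, mul_zero,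
          Finset.sum_ite_eq, Finset.mem_univ, if_true, Finset.mul_sum]
      · simp [swapWeight, h]
    · intro x hx
      simp [swapWeight, Ne.symm hx]
    · intro x hx
      simp [swapWeight, Ne.symm hx]
  rw [hsum]
  simp only [hin, Finset.sum_ite_eq, Finset.mem_univ, if_true]
  push_cast
  refine Finset.sum_congr rfl fun s _ => Finset.sum_congr rfl fun s' _ => ?_
  rw [← Complex.ofReal_pow, ← Complex.normSq_eq_norm_sq, ← Complex.mul_conj, map_sum,
    Finset.sum_mul]
  rfl

lemma hsSq_regroup_mul_conjTranspose (e : σ × τ ≃ g) (N : Matrix b g ℂ) :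
    hsSq (regroup e N * (regroup e N)ᴴ) =
      ∑ k, ∑ k', ∑ s, ∑ s', ‖∑ c, N k (e (s, c)) * star (N k' (e (s', c)))‖ ^ 2 := by
  have h : ∀ s k s' k', (regroup e N * (regroup e N)ᴴ) (s, k) (s', k') =
      ∑ c, N k (e (s, c)) * star (N k' (e (s', c))) := fun _ _ _ _ => rfl
  simp only [hsSq, Fintype.sum_prod_type, h]
  rw [Finset.sum_comm]
  refine Finset.sum_congr rfl fun k _ => ?_
  rw [Finset.sum_comm (s := (Finset.univ : Finset b))]
  refine Finset.sum_congr rfl fun s _ => ?_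
  rw [Finset.sum_comm]

end Decoupling

section Fluctuation

variable {Ω : Type*} [MeasurableSpace Ω] {P : Measure Ω} [IsProbabilityMeasure P]
variable {g a b : Type*} [Fintype g] [Fintype a] [Fintype b] [DecidableEq g]

/-- If the covariance of the entries of `T * Tᴴ` is a sum of pairings over tensor factorizations,
then the mean square of `X * (T * Tᴴ - 1) * Xᴴ` is the corresponding sum of purities of reduced
states. -/
lemma integral_hsSq_fluctuation {J : Type*} {σ τ : J → Type*} [∀ j, Fintype (σ j)]
    [∀ j, Fintype (τ j)] [∀ j, DecidableEq (σ j)] [∀ j, DecidableEq (τ j)]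
    (e : ∀ j, σ j × τ j ≃ g) (s : Finset J) {T : Ω → Matrix g a ℂ}
    (hint : ∀ i j, Integrable (fun t => (T t * (T t)ᴴ) i j) P)
    (hmean : ∀ i j, ∫ t, (T t * (T t)ᴴ) i j ∂P = (1 : Matrix g g ℂ) i j)
    (hint₂ : ∀ p q : g × g, Integrable
      (fun t => (T t * (T t)ᴴ) p.1 p.2 * star ((T t * (T t)ᴴ) q.1 q.2)) P)
    (hfour : ∀ p q : g × g,
      ∫ t, (T t * (T t)ᴴ) p.1 p.2 * star ((T t * (T t)ᴴ) q.1 q.2) ∂P =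
        (1 : Matrix g g ℂ) p.1 p.2 * (1 : Matrix g g ℂ) q.1 q.2 +
          ∑ j ∈ s, swapWeight (e j) p q)
    (X : Matrix b g ℂ) :
    Integrable (fun t => hsSq (X * (T t * (T t)ᴴ - 1) * Xᴴ)) P ∧
    ∫ t, hsSq (X * (T t * (T t)ᴴ - 1) * Xᴴ) ∂P =
      ∑ j ∈ s, hsSq (regroup (e j) X * (regroup (e j) X)ᴴ) := by
  set M : Ω → Matrix g g ℂ := fun t => T t * (T t)ᴴ with hM
  have hone : ∀ q : g × g, star ((1 : Matrix g g ℂ) q.1 q.2) = (1 : Matrix g g ℂ) q.1 q.2 := by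
    intro q; rw [Matrix.one_apply]; split_ifs <;> simp
  have hexp : ∀ t (p q : g × g), (M t - 1) p.1 p.2 * star ((M t - 1) q.1 q.2) =
      M t p.1 p.2 * star (M t q.1 q.2) - (1 : Matrix g g ℂ) p.1 p.2 * star (M t q.1 q.2)
        - (M t p.1 p.2 * (1 : Matrix g g ℂ) q.1 q.2
          - (1 : Matrix g g ℂ) p.1 p.2 * (1 : Matrix g g ℂ) q.1 q.2) := by
    intro t p q
    rw [Matrix.sub_apply, Matrix.sub_apply, star_sub, hone]; ring
  have hstar : ∀ q : g × g, Integrable (fun t => star (M t q.1 q.2)) P := fun q => by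
    have := (hint q.1 q.2)
    exact (integrable_norm_iff ((continuous_star (R := ℂ)).comp_aestronglyMeasurable this.1)).1
      (by simpa using this.norm)
  have hi₁ : ∀ p q : g × g, Integrable (fun t => M t p.1 p.2 * star (M t q.1 q.2)
      - (1 : Matrix g g ℂ) p.1 p.2 * star (M t q.1 q.2)) P :=
    fun p q => (hint₂ p q).sub ((hstar q).const_mul _)
  have hi₂ : ∀ p q : g × g, Integrable (fun t => M t p.1 p.2 * (1 : Matrix g g ℂ) q.1 q.2
      - (1 : Matrix g g ℂ) p.1 p.2 * (1 : Matrix g g ℂ) q.1 q.2) P :=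
    fun p q => ((hint p.1 p.2).mul_const _).sub (integrable_const _)
  have hi : ∀ p q : g × g,
      Integrable (fun t => (M t - 1) p.1 p.2 * star ((M t - 1) q.1 q.2)) P := by
    intro p q
    simp_rw [hexp]
    exact (hi₁ p q).sub (hi₂ p q)
  have hcov : ∀ p q : g × g, ∫ t, (M t - 1) p.1 p.2 * star ((M t - 1) q.1 q.2) ∂P =
      ∑ j ∈ s, swapWeight (e j) p q := by
    intro p q
    have hs : ∫ t, star (M t q.1 q.2) ∂P = (1 : Matrix g g ℂ) q.1 q.2 := by
      rw [← hone, ← hmean]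
      exact integral_conj (f := fun t => M t q.1 q.2)
    simp_rw [hexp]
    rw [integral_sub (hi₁ p q) (hi₂ p q), integral_sub (hint₂ p q) ((hstar q).const_mul _),
      integral_sub ((hint p.1 p.2).mul_const _) (integrable_const _), hfour, integral_const_mul,
      integral_mul_const, hs, hmean]
    simp
  set F : b → b → g → g → ℂ := fun k k' i j => X k i * star (X k' j) with hF
  have hsq : ∀ t, ((hsSq (X * (M t - 1) * Xᴴ) : ℝ) : ℂ) =
      ∑ k, ∑ k', ∑ p : g × g, ∑ q : g × g, F k k' p.1 p.2 * star (F k k' q.1 q.2) *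
        ((M t - 1) p.1 p.2 * star ((M t - 1) q.1 q.2)) := by
    intro t
    simp only [hsSq, Complex.ofReal_sum]
    refine Finset.sum_congr rfl fun k _ => Finset.sum_congr rfl fun k' _ => ?_
    rw [← Complex.normSq_eq_norm_sq, ← Complex.mul_conj, mul_mul_conjTranspose_apply, map_sum,
      Finset.sum_mul_sum]
    refine Finset.sum_congr rfl fun p _ => Finset.sum_congr rfl fun q _ => ?_
    rw [map_mul, hF]
    simp only [RCLike.star_def]
    ring
  have hI : ∀ k k' (p q : g × g), Integrable (fun t => F k k' p.1 p.2 * star (F k k' q.1 q.2) *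
        ((M t - 1) p.1 p.2 * star ((M t - 1) q.1 q.2))) P :=
    fun k k' p q => (hi p q).const_mul _
  have hI2 : ∀ k k', Integrable (fun t => ∑ p : g × g, ∑ q : g × g,
      F k k' p.1 p.2 * star (F k k' q.1 q.2) *
        ((M t - 1) p.1 p.2 * star ((M t - 1) q.1 q.2))) P :=
    fun k k' => integrable_finsetSum _ fun p _ => integrable_finsetSum _ fun q _ => hI k k' p q
  have hIr : Integrable (fun t => ((hsSq (X * (M t - 1) * Xᴴ) : ℝ) : ℂ)) P := by
    simp_rw [hsq]
    exact integrable_finsetSum _ fun k _ => integrable_finsetSum _ fun k' _ => hI2 k k'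
  refine ⟨by simpa using hIr.re, ?_⟩
  have h2 : ((∫ t, hsSq (X * (M t - 1) * Xᴴ) ∂P : ℝ) : ℂ) =
      ((∑ j ∈ s, hsSq (regroup (e j) X * (regroup (e j) X)ᴴ) : ℝ) : ℂ) := by
    rw [← integral_complex_ofReal]
    simp_rw [hsq]
    have hj : ∀ j, ((hsSq (regroup (e j) X * (regroup (e j) X)ᴴ) : ℝ) : ℂ) =
        ∑ k, ∑ k', ∑ p : g × g, ∑ q : g × g, F k k' p.1 p.2 * star (F k k' q.1 q.2) *
          swapWeight (e j) p q := by
      intro j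
      rw [hsSq_regroup_mul_conjTranspose, Complex.ofReal_sum]
      refine Finset.sum_congr rfl fun k _ => ?_
      rw [Complex.ofReal_sum]
      exact Finset.sum_congr rfl fun k' _ => (sum_swapWeight (e j) (F k k')).symm
    rw [Complex.ofReal_sum, Finset.sum_congr rfl fun j _ => hj j]
    rw [integral_finsetSum _ fun k _ => integrable_finsetSum _ fun k' _ => hI2 k k']
    refine Eq.trans (Finset.sum_congr rfl fun k _ => ?_) Finset.sum_comm
    rw [integral_finsetSum _ fun k' _ => hI2 k k']
    refine Eq.trans (Finset.sum_congr rfl fun k' _ => ?_) Finset.sum_comm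
    rw [integral_finsetSum _ fun p _ => integrable_finsetSum _ fun q _ => hI k k' p q]
    refine Eq.trans (Finset.sum_congr rfl fun p _ => ?_) Finset.sum_comm
    rw [integral_finsetSum _ fun q _ => hI k k' p q]
    refine Eq.trans (Finset.sum_congr rfl fun q _ => ?_) Finset.sum_comm
    rw [integral_const_mul, hcov, Finset.mul_sum]
  exact_mod_cast h2

end Fluctuation

/-! ### Collision entropy -/

section Entropy

variable {g b σ τ : Type*} [Fintype g] [Fintype b] [Fintype σ] [Fintype τ] [DecidableEq b]
  [DecidableEq σ]

/-- Both `N * Nᴴ` and `regroup e N * (regroup e N)ᴴ` are reduced states of the pure state with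
coefficient matrix `N`; the second one keeps the factor `σ` in addition. -/
lemma traceFirst_regroup (e : σ × τ ≃ g) (N : Matrix b g ℂ) :
    traceFirst (regroup e N * (regroup e N)ᴴ) = N * Nᴴ := by
  ext k k'
  simp only [traceFirst, Matrix.mul_apply, Matrix.conjTranspose_apply, regroup]
  rw [← e.sum_comp, Fintype.sum_prod_type]

lemma hsSq_regroup (e : σ × τ ≃ g) (N : Matrix b g ℂ) : hsSq (regroup e N) = hsSq N := by
  simp only [hsSq, Fintype.sum_prod_type, regroup]
  rw [Finset.sum_comm]
  refine Finset.sum_congr rfl fun k _ => ?_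
  rw [← e.sum_comp, Fintype.sum_prod_type]

lemma one_kronecker_mul_regroup (e : σ × τ ≃ g) (p : Matrix b b ℂ) (N : Matrix b g ℂ) :
    ((1 : Matrix σ σ ℂ) ⊗ₖ p) * regroup e N = regroup e (p * N) := by
  ext ⟨s, k⟩ c
  simp [Matrix.mul_apply, regroup, Fintype.sum_prod_type, Matrix.kroneckerMap_apply,
    Matrix.one_apply]

lemma sandwiched_regroup (e : σ × τ ≃ g) (N : Matrix b g ℂ) :
    sandwiched (regroup e N * (regroup e N)ᴴ) =
      regroup e (power (N * Nᴴ) (-(1 / 4)) * N) *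
        (regroup e (power (N * Nᴴ) (-(1 / 4)) * N))ᴴ := by
  have h : ((1 : Matrix σ σ ℂ) ⊗ₖ power (N * Nᴴ) (-(1 / 4)))ᴴ =
      (1 : Matrix σ σ ℂ) ⊗ₖ power (N * Nᴴ) (-(1 / 4)) := by
    rw [Matrix.conjTranspose_kronecker, conjTranspose_power, Matrix.conjTranspose_one]
  rw [sandwiched, traceFirst_regroup, ← one_kronecker_mul_regroup, Matrix.conjTranspose_mul, h]
  simp only [Matrix.mul_assoc]

lemma hsSq_regroup_le_of_le_condH2 (e : σ × τ ≃ g) (N : Matrix b g ℂ) {K : ℝ}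
    (hK : K ≤ condH2 (regroup e N * (regroup e N)ᴴ)) :
    hsSq (regroup e (power (N * Nᴴ) (-(1 / 4)) * N) *
        (regroup e (power (N * Nᴴ) (-(1 / 4)) * N))ᴴ) ≤ hsSq N * 2 ^ (-K) := by
  rw [condH2, sandwiched_regroup, ← hsSq_eq_re_trace, hsSq_regroup] at hK
  set R := regroup e (power (N * Nᴴ) (-(1 / 4)) * N) with hR
  have h1 : ((R * Rᴴ) ^ 2).trace.re = hsSq (R * Rᴴ) := by
    rw [hsSq_eq_re_trace, Matrix.conjTranspose_mul, Matrix.conjTranspose_conjTranspose, pow_two]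
  rw [h1] at hK
  -- `logb 2 0 = 0` is a junk value, so the case of vanishing purity is treated separately.
  rcases (hsSq_nonneg (R * Rᴴ)).eq_or_lt with h0 | h0
  · rw [← h0]
    exact mul_nonneg (hsSq_nonneg N) (Real.rpow_nonneg (by norm_num) _)
  · have hN : 0 < hsSq N := by
      refine (hsSq_nonneg N).lt_of_ne fun h => h0.ne' ?_
      have : N = 0 := by
        have h2 := trace_mul_conjTranspose_self N
        rw [← h, Complex.ofReal_zero] at h2
        exact Matrix.trace_mul_conjTranspose_self_eq_zero_iff.1 h2
      have h3 : R = 0 := by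
        rw [hR, this, Matrix.mul_zero]; rfl
      simp [h3, hsSq]
    have h2 : Real.logb 2 (hsSq (R * Rᴴ)) ≤ Real.logb 2 (hsSq N) + -K := by linarith
    have h3 := Real.rpow_le_rpow_of_exponent_le (x := 2) (by norm_num) h2
    rwa [Real.rpow_add (by norm_num), Real.rpow_logb (by norm_num) (by norm_num) h0,
      Real.rpow_logb (by norm_num) (by norm_num) hN] at h3

end Entropy

/-! ### The random matrix on one side of a cut -/

lemma isIsometry_map_star {m n : Type*} [Fintype m] [Fintype n] [DecidableEq n]
    {W : Matrix m n ℂ} (hW : IsIsometry W) : IsIsometry (W.map star) := by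
  have h : (W.map star)ᴴ * W.map star = (Wᴴ * W)ᴴᵀ := by
    ext i j
    simp [Matrix.mul_apply, mul_comm]
  rw [IsIsometry, h, show Wᴴ * W = 1 from hW]
  simp

section Cuts

variable {V : Type*} [Fintype V] [DecidableEq V] {ι : V → Type*} {bd P Q S D : Finset V}

/-- The entry `i` of the tensor at the vertex `x`, extended by `1` to the boundary vertices, where
there is no tensor. -/
def amp (t : Tensors ι bd) (x : V) (i : ι x) : ℂ :=
  if h : x ∈ bd then 1 else t ⟨x, Finset.mem_compl.2 h⟩ i

/-- The random matrix `H_D → H_P` of one side `P` of a cut, where `D = P ∩ bd`: the identity at the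
boundary vertices, tensored with the conjugate of the random vector at each bulk vertex. -/
def cutTensor [∀ x, DecidableEq (ι x)] (hD : D ⊆ P) (t : Tensors ι bd) :
    Matrix (Cfg ι P) (Cfg ι D) ℂ :=
  fun g a => if Finset.restrict₂ (π := ι) hD g = a then ∏ x : P, star (amp t x (g x)) else 0

/-- The tensor factor at the vertex `x` of `cutTensor hD t * (cutTensor hD t)ᴴ`: the identity on the
boundary, and the rank-one operator of the conjugate random vector in the bulk. -/
def vertexOp [∀ x, DecidableEq (ι x)] (t : Tensors ι bd) (x : V) (i j : ι x) : ℂ :=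
  if h : x ∈ bd then (if i = j then 1 else 0)
  else starRingEnd ℂ (t ⟨x, Finset.mem_compl.2 h⟩ i) * t ⟨x, Finset.mem_compl.2 h⟩ j

lemma cutTensor_mul_conjTranspose [∀ x, Fintype (ι x)] [∀ x, DecidableEq (ι x)] (hD : D ⊆ P)
    (hPD : P ∩ bd = D) (t : Tensors ι bd) (g g' : Cfg ι P) :
    (cutTensor hD t * (cutTensor hD t)ᴴ) g g' = ∏ x : P, vertexOp t x (g x) (g' x) := by
  simp only [Matrix.mul_apply, Matrix.conjTranspose_apply, cutTensor]
  rw [Finset.sum_eq_single (Finset.restrict₂ (π := ι) hD g)]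
  · rw [if_pos rfl]
    by_cases h : Finset.restrict₂ (π := ι) hD g' = Finset.restrict₂ (π := ι) hD g
    · rw [if_pos h, star_prod, ← Finset.prod_mul_distrib]
      refine Finset.prod_congr rfl fun x _ => ?_
      rw [star_star, vertexOp, amp, amp]
      by_cases hx : x.1 ∈ bd
      · have hxD : x.1 ∈ D := by rw [← hPD]; exact Finset.mem_inter.2 ⟨x.2, hx⟩
        have := congrFun h ⟨x.1, hxD⟩
        simp only [Finset.restrict₂] at this
        simp [hx, this]
      · simp [hx]
    · rw [if_neg h, star_zero, mul_zero]
      obtain ⟨x, hx⟩ := Function.ne_iff.1 h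
      have hxD : x.1 ∈ P ∩ bd := by rw [hPD]; exact x.2
      rw [Finset.mem_inter] at hxD
      refine (Finset.prod_eq_zero (Finset.mem_univ (⟨x.1, hxD.1⟩ : P)) ?_).symm
      rw [vertexOp, dif_pos hxD.2, if_neg]
      exact fun h' => hx h'.symm
  · intro a _ ha
    rw [if_neg (Ne.symm ha), zero_mul]
  · simp

/-- A product over `P` splits into a product over the boundary vertices of `P` and a product over
all bulk vertices, with trivial factors outside `P`. -/
lemma prod_dite_bulk (P bd : Finset V) (c : P → ℂ) (r : ∀ x : P, x.1 ∉ bd → ℂ) :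
    ∏ x : P, (if h : x.1 ∈ bd then c x else r x h) =
      (∏ x : P, if x.1 ∈ bd then c x else 1) *
      ∏ y : (bdᶜ : Finset V), if h : y.1 ∈ P then r ⟨y.1, h⟩ (Finset.mem_compl.1 y.2) else 1 := by
  have hP : ∀ (R : Finset V) (F : R → ℂ),
      ∏ x : R, F x = ∏ x : V, if h : x ∈ R then F ⟨x, h⟩ else 1 := by
    intro R F
    set G : V → ℂ := fun x => if h : x ∈ R then F ⟨x, h⟩ else 1 with hG
    calc ∏ x : R, F x = ∏ x : R, G x.1 :=
          Finset.prod_congr rfl fun x _ => by simp [hG]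
      _ = ∏ x ∈ R, G x := Finset.prod_coe_sort R G
      _ = ∏ x : V, G x := Finset.prod_subset (Finset.subset_univ R) fun x _ hx => dif_neg hx
  rw [hP, hP, hP, ← Finset.prod_mul_distrib]
  refine Finset.prod_congr rfl fun x _ => ?_
  by_cases h1 : x ∈ P <;> by_cases h2 : x ∈ bd <;> simp [h1, h2]

variable [∀ x, Fintype (ι x)]

instance : IsProbabilityMeasure (tensorLaw ι bd) := by unfold tensorLaw; infer_instance

/-- The expectation of a product of functions of the individual tensors factorizes. -/
lemma integral_prod_vertices (P bd : Finset V) (c : P → ℂ) (f : ∀ x : P, (ι x → ℂ) → ℂ)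
    (hf : ∀ x, Integrable (f x) (vectorLaw (ι x))) :
    Integrable (fun t : Tensors ι bd => ∏ x : P,
      (if h : x.1 ∈ bd then c x else f x (t ⟨x.1, Finset.mem_compl.2 h⟩))) (tensorLaw ι bd) ∧
    ∫ t : Tensors ι bd, ∏ x : P,
      (if h : x.1 ∈ bd then c x else f x (t ⟨x.1, Finset.mem_compl.2 h⟩)) ∂tensorLaw ι bd =
      ∏ x : P, if x.1 ∈ bd then c x else ∫ z, f x z ∂vectorLaw (ι x) := by
  set G : ∀ y : (bdᶜ : Finset V), (ι y → ℂ) → ℂ :=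
    fun y z => if h : y.1 ∈ P then f ⟨y.1, h⟩ z else 1 with hG
  have h : ∀ t : Tensors ι bd, ∏ x : P,
      (if h : x.1 ∈ bd then c x else f x (t ⟨x.1, Finset.mem_compl.2 h⟩)) =
      (∏ x : P, if x.1 ∈ bd then c x else 1) * ∏ y : (bdᶜ : Finset V), G y (t y) :=
    fun t => prod_dite_bulk P bd c fun x h => f x (t ⟨x.1, Finset.mem_compl.2 h⟩)
  have hr := prod_dite_bulk P bd c fun x _ => ∫ z, f x z ∂vectorLaw (ι x)
  simp only [dite_eq_ite] at hr
  have hlaw : tensorLaw ι bd = Measure.pi fun x : (bdᶜ : Finset V) => vectorLaw (ι x) := rfl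
  have hGi : ∀ y, Integrable (G y) (vectorLaw (ι y)) := by
    intro y
    by_cases hy : y.1 ∈ P
    · have : G y = f ⟨y.1, hy⟩ := by ext z; simp [hG, hy]
      rw [this]; exact hf ⟨y.1, hy⟩
    · have : G y = fun _ => 1 := by ext z; simp [hG, hy]
      rw [this]; exact integrable_const _
  have hGp : Integrable (fun t : Tensors ι bd => ∏ y : (bdᶜ : Finset V), G y (t y))
      (Measure.pi fun x : (bdᶜ : Finset V) => vectorLaw (ι x)) :=
    Integrable.fintype_prod_dep hGi
  have hGv : ∫ t : Tensors ι bd, ∏ y : (bdᶜ : Finset V), G y (t y)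
      ∂(Measure.pi fun x : (bdᶜ : Finset V) => vectorLaw (ι x)) =
      ∏ y : (bdᶜ : Finset V), ∫ z, G y z ∂vectorLaw (ι y) := integral_fintype_prod_eq_prod G
  simp_rw [h]
  rw [hr, hlaw]
  refine ⟨hGp.const_mul _, ?_⟩
  rw [integral_const_mul, hGv]
  congr 1
  refine Finset.prod_congr rfl fun y _ => ?_
  by_cases hy : y.1 ∈ P <;> simp [hy, hG]

variable [∀ x, DecidableEq (ι x)]

lemma integral_cutTensor_mul_conjTranspose (hD : D ⊆ P) (hPD : P ∩ bd = D) (g g' : Cfg ι P) :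
    Integrable (fun t : Tensors ι bd => (cutTensor hD t * (cutTensor hD t)ᴴ) g g')
      (tensorLaw ι bd) ∧
    ∫ t : Tensors ι bd, (cutTensor hD t * (cutTensor hD t)ᴴ) g g' ∂tensorLaw ι bd =
      (1 : Matrix (Cfg ι P) (Cfg ι P) ℂ) g g' := by
  simp_rw [cutTensor_mul_conjTranspose hD hPD, vertexOp]
  have h := integral_prod_vertices P bd (fun x => if g x = g' x then 1 else 0)
    (fun x z => starRingEnd ℂ (z (g x)) * z (g' x)) (fun x => integrable_conj_mul _ _)
  refine ⟨h.1, h.2.trans ?_⟩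
  simp_rw [integral_conj_mul, ite_self]
  rw [Fintype.prod_ite_zero, Matrix.one_apply]
  simp [funext_iff]

/-- The factorization `H_P = H_S ⊗ H_{P \ S}` for `S ⊆ P`. With `Q` the complement of `P`, the set
`P \ S` is written as the complement of `S ∪ Q`, the form in which it occurs in the reduced state on
`S ∪ Q`. -/
def cutEquiv (hPQ : ∀ x, x ∈ Q ↔ x ∉ P) (hS : S ⊆ P) :
    Cfg ι S × Cfg ι (S ∪ Q)ᶜ ≃ Cfg ι P where
  toFun p := fun x => if h : x.1 ∈ S then p.1 ⟨x.1, h⟩ else p.2 ⟨x.1, by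
    have := x.2
    simp [h, hPQ]⟩
  invFun g := (fun x => g ⟨x.1, hS x.2⟩, fun x => g ⟨x.1, by
    have := x.2
    simp only [Finset.mem_compl, Finset.mem_union, hPQ, not_or, not_not] at this
    exact this.2⟩)
  left_inv p := by
    ext x
    · simp
    · have := x.2
      simp only [Finset.mem_compl, Finset.mem_union, not_or] at this
      simp [this.1]
  right_inv g := by
    ext x
    by_cases h : x.1 ∈ S <;> simp [h]

lemma swapWeight_cutEquiv (hPQ : ∀ x, x ∈ Q ↔ x ∉ P) (hS : S ⊆ P) (p q : Cfg ι P × Cfg ι P) :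
    swapWeight (cutEquiv hPQ hS) p q = ∏ x : P,
      (if x.1 ∈ S then (if p.1 x = q.1 x then 1 else 0) * (if p.2 x = q.2 x then 1 else 0)
        else (if p.1 x = p.2 x then 1 else 0) * (if q.1 x = q.2 x then 1 else 0)) := by
  have h : ∀ x : P, (if x.1 ∈ S then
        (if p.1 x = q.1 x then (1 : ℂ) else 0) * (if p.2 x = q.2 x then 1 else 0)
        else (if p.1 x = p.2 x then 1 else 0) * (if q.1 x = q.2 x then 1 else 0)) =
      if (x.1 ∈ S → p.1 x = q.1 x ∧ p.2 x = q.2 x) ∧ (x.1 ∉ S → p.1 x = p.2 x ∧ q.1 x = q.2 x)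
        then 1 else 0 := by
    intro x
    by_cases hx : x.1 ∈ S
    · simp [hx, ← ite_and, and_comm]
    · simp [hx, ← ite_and, and_comm]
  simp_rw [h]
  rw [Fintype.prod_ite_zero, swapWeight, Finset.prod_const_one]
  refine if_congr ?_ rfl rfl
  simp only [cutEquiv, Equiv.coe_fn_symm_mk, funext_iff]
  constructor
  · rintro ⟨⟨h1, h2⟩, h3, h4⟩ x
    refine ⟨fun hx => ⟨h1 ⟨x.1, hx⟩, h2 ⟨x.1, hx⟩⟩, fun hx => ?_⟩
    have hx' : x.1 ∈ (S ∪ Q)ᶜ := by simp [hx, hPQ]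
    exact ⟨h3 ⟨x.1, hx'⟩, h4 ⟨x.1, hx'⟩⟩
  · intro h
    have hc : ∀ x : ((S ∪ Q)ᶜ : Finset V), x.1 ∉ S ∧ x.1 ∈ P := by
      intro x
      have := x.2
      simpa only [Finset.mem_compl, Finset.mem_union, hPQ, not_or, not_not] using this
    exact ⟨⟨fun x => ((h ⟨x.1, hS x.2⟩).1 x.2).1, fun x => ((h ⟨x.1, hS x.2⟩).1 x.2).2⟩,
      fun x => ((h ⟨x.1, (hc x).2⟩).2 (hc x).1).1, fun x => ((h ⟨x.1, (hc x).2⟩).2 (hc x).1).2⟩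

/-- The nonempty sets of bulk vertices in `P`. -/
def bulkSubsets (P bd : Finset V) : Finset (Finset P) :=
  Finset.univ.filter fun S => S ≠ ∅ ∧ ∀ x ∈ S, x.1 ∉ bd

lemma map_subtype_subset (S : Finset P) : S.map (Function.Embedding.subtype (· ∈ P)) ⊆ P := by
  intro x hx
  obtain ⟨y, _, rfl⟩ := Finset.mem_map.1 hx
  exact y.2

lemma card_bulkSubsets_le (P bd : Finset V) : (bulkSubsets P bd).card ≤ 2 ^ (bdᶜ).card := by
  have h : bulkSubsets P bd ⊆ (Finset.univ.filter fun x : P => x.1 ∉ bd).powerset := by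
    intro S hS
    rw [Finset.mem_powerset]
    intro x hx
    rw [bulkSubsets, Finset.mem_filter] at hS
    simpa using hS.2.2 x hx
  refine (Finset.card_le_card h).trans ?_
  rw [Finset.card_powerset]
  refine Nat.pow_le_pow_right (by norm_num) ?_
  refine Finset.card_le_card_of_injOn (fun x => x.1) ?_ Subtype.val_injective.injOn
  intro x hx
  simpa using hx

/-- The fourth moments of `cutTensor`. Wick's formula gives two pairings at each bulk vertex, so the
expectation is a sum over the sets `S` of bulk vertices at which the crossed pairing is chosen; the
first term on the right is that of `S = ∅`. -/
lemma integral_cutTensor_four (hD : D ⊆ P) (hPD : P ∩ bd = D) (hPQ : ∀ x, x ∈ Q ↔ x ∉ P)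
    (p q : Cfg ι P × Cfg ι P) :
    Integrable (fun t : Tensors ι bd => (cutTensor hD t * (cutTensor hD t)ᴴ) p.1 p.2 *
      star ((cutTensor hD t * (cutTensor hD t)ᴴ) q.1 q.2)) (tensorLaw ι bd) ∧
    ∫ t : Tensors ι bd, (cutTensor hD t * (cutTensor hD t)ᴴ) p.1 p.2 *
      star ((cutTensor hD t * (cutTensor hD t)ᴴ) q.1 q.2) ∂tensorLaw ι bd =
      (1 : Matrix (Cfg ι P) (Cfg ι P) ℂ) p.1 p.2 * (1 : Matrix (Cfg ι P) (Cfg ι P) ℂ) q.1 q.2 +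
      ∑ S ∈ bulkSubsets P bd, swapWeight (cutEquiv hPQ (map_subtype_subset S)) p q := by
  have hv : ∀ t : Tensors ι bd, (cutTensor hD t * (cutTensor hD t)ᴴ) p.1 p.2 *
      star ((cutTensor hD t * (cutTensor hD t)ᴴ) q.1 q.2) =
      ∏ x : P, (if h : x.1 ∈ bd then
        (if p.1 x = p.2 x then 1 else 0) * (if q.1 x = q.2 x then 1 else 0)
        else (fun z : ι x → ℂ => starRingEnd ℂ (z (p.1 x)) * z (p.2 x) *
          starRingEnd ℂ (starRingEnd ℂ (z (q.1 x)) * z (q.2 x)))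
          (t ⟨x.1, Finset.mem_compl.2 h⟩)) := by
    intro t
    rw [cutTensor_mul_conjTranspose hD hPD, cutTensor_mul_conjTranspose hD hPD, star_prod,
      ← Finset.prod_mul_distrib]
    refine Finset.prod_congr rfl fun x _ => ?_
    rw [vertexOp, vertexOp]
    by_cases hx : x.1 ∈ bd
    · simp only [hx, dif_pos]
      by_cases hq : q.1 x = q.2 x <;> simp [hq]
    · simp only [hx, dif_neg, not_false_eq_true]; rfl
  simp_rw [hv]
  have h := integral_prod_vertices P bd
    (fun x => (if p.1 x = p.2 x then 1 else 0) * (if q.1 x = q.2 x then 1 else 0))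
    (fun x (z : ι x → ℂ) => starRingEnd ℂ (z (p.1 x)) * z (p.2 x) *
          starRingEnd ℂ (starRingEnd ℂ (z (q.1 x)) * z (q.2 x)))
    (fun x => integrable_conj_mul_mul_conj _ _ _ _)
  refine ⟨h.1, h.2.trans ?_⟩
  set A : P → ℂ := fun x => (if p.1 x = p.2 x then 1 else 0) * (if q.1 x = q.2 x then 1 else 0)
    with hA
  set B : P → ℂ := fun x => if x.1 ∈ bd then 0 else
    (if p.1 x = q.1 x then 1 else 0) * (if p.2 x = q.2 x then 1 else 0) with hB
  have h1 : ∀ x : P, (if x.1 ∈ bd then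
      (if p.1 x = p.2 x then (1 : ℂ) else 0) * (if q.1 x = q.2 x then 1 else 0)
      else ∫ z : ι x → ℂ, starRingEnd ℂ (z (p.1 x)) * z (p.2 x) *
          starRingEnd ℂ (starRingEnd ℂ (z (q.1 x)) * z (q.2 x)) ∂vectorLaw (ι x)) = B x + A x := by
    intro x
    rw [integral_conj_mul_mul_conj]
    by_cases hx : x.1 ∈ bd
    · simp [hA, hB, hx]
    · simp only [hx, if_false, hA, hB]; ring
  rw [Finset.prod_congr rfl fun x _ => h1 x, Finset.prod_add, Finset.powerset_univ,
    ← Finset.add_sum_erase _ _ (Finset.mem_univ ∅)]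
  congr 1
  · have : ∀ f f' : Cfg ι P, (1 : Matrix (Cfg ι P) (Cfg ι P) ℂ) f f' =
        ∏ x, if f x = f' x then 1 else 0 := by
      intro f f'
      rw [Fintype.prod_ite_zero, Matrix.one_apply]
      simp [funext_iff]
    rw [this, this, ← Finset.prod_mul_distrib]
    simp [hA]
  · rw [← Finset.sum_subset (s₁ := bulkSubsets P bd)]
    · refine Finset.sum_congr rfl fun S hS => ?_
      rw [bulkSubsets, Finset.mem_filter] at hS
      rw [swapWeight_cutEquiv, ← Finset.prod_mul_prod_compl S, Finset.compl_eq_univ_sdiff]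
      congr 1
      · refine Finset.prod_congr rfl fun x hx => ?_
        have : x.1 ∈ S.map (Function.Embedding.subtype (· ∈ P)) :=
          Finset.mem_map.2 ⟨x, hx, rfl⟩
        rw [if_pos this, hB]
        simp [hS.2.2 x hx]
      · refine Finset.prod_congr rfl fun x hx => ?_
        have : x.1 ∉ S.map (Function.Embedding.subtype (· ∈ P)) := by
          intro hx'
          obtain ⟨y, hy, hyx⟩ := Finset.mem_map.1 hx'
          have : y = x := Subtype.ext hyx
          rw [Finset.mem_sdiff, ← this] at hx
          exact hx.2 hy
        rw [if_neg this]
    · intro S hS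
      rw [bulkSubsets, Finset.mem_filter] at hS
      simp [hS.2.1]
    · intro S hS hS'
      have hne : S ≠ ∅ := (Finset.mem_erase.1 hS).1
      have : ∃ x ∈ S, x.1 ∈ bd := by
        by_contra hcon
        push Not at hcon
        exact hS' (Finset.mem_filter.2 ⟨Finset.mem_univ _, hne, hcon⟩)
      obtain ⟨x, hx, hxb⟩ := this
      rw [Finset.prod_eq_zero hx (by simp [hB, hxb]), zero_mul]

variable {κ : Type*} [Fintype κ] [DecidableEq κ]

lemma reducedBipartite_pureState (hPQ : ∀ x, x ∈ Q ↔ x ∉ P) (hS : S ⊆ P) {v : Full ι κ → ℂ}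
    {N : Matrix (Cfg ι Q × κ) (Cfg ι P) ℂ}
    (hN : ∀ f r, N (Q.restrict f, r) (P.restrict f) = v (f, r)) :
    reducedBipartite S Q (pureState v) =
      regroup (cutEquiv hPQ hS) N * (regroup (cutEquiv hPQ hS) N)ᴴ := by
  have h : ∀ (s : Cfg ι S) (k : Cfg ι Q) (r : κ) (c : Cfg ι (S ∪ Q)ᶜ),
      v (glue (glueUnion s k) c, r) = regroup (cutEquiv hPQ hS) N (s, (k, r)) c := by
    intro s k r c
    rw [← hN, regroup]
    congr 2
    · ext x
      have hxS : x.1 ∉ S := fun h => (hPQ x.1).1 x.2 (hS h)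
      have hx : x.1 ∈ S ∪ Q := Finset.mem_union_right _ x.2
      simp [glue, glueUnion, hx, hxS]
    · ext x
      by_cases hxS : x.1 ∈ S
      · have hx : x.1 ∈ S ∪ Q := Finset.mem_union_left _ hxS
        simp [glue, glueUnion, hx, hxS, cutEquiv]
      · have hx : x.1 ∉ S ∪ Q := by simp [hxS, hPQ]
        simp [glue, hx, hxS, cutEquiv]
  ext ⟨s, k, r⟩ ⟨s', k', r'⟩
  simp only [reducedBipartite, Matrix.submatrix_apply, reduced, pureState, Matrix.vecMulVec_apply,
    Pi.star_apply, h, Matrix.mul_apply, Matrix.conjTranspose_apply]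

lemma card_cfg_le [∀ x, Nonempty (ι x)] (hD : D ⊆ P) :
    Fintype.card (Cfg ι D) ≤ Fintype.card (Cfg ι P) := by
  refine Fintype.card_le_of_surjective (Finset.restrict₂ (π := ι) hD) fun a => ?_
  classical
  refine ⟨fun x => if h : x.1 ∈ D then a ⟨x.1, h⟩ else Classical.arbitrary _, ?_⟩
  ext x
  simp [Finset.restrict₂]

/-- Recovery on one side `P` of a cut. Lower bounds on the collision entropies of all nonempty sets
of bulk vertices in `P`, conditioned on the other side and the reference, provide an isometry for
every realization of the tensors that undoes the contraction on `P` up to an error of small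
expectation. The integrable bound `h` takes the place of the error, as `W` need not depend
measurably on `t`. -/
theorem exists_oneSided_recovery [∀ x, Nonempty (ι x)] (hD : D ⊆ P) (hPD : P ∩ bd = D)
    (hPQ : ∀ x, x ∈ Q ↔ x ∉ P)
    {v : Full ι κ → ℂ} {N : Matrix (Cfg ι Q × κ) (Cfg ι P) ℂ}
    (hN : ∀ f r, N (Q.restrict f, r) (P.restrict f) = v (f, r)) {K μ : ℝ} (hμ : 0 < μ)
    (hμK : μ ^ 2 = 2 ^ (bdᶜ).card * 2 ^ (-K))
    (hK : ∀ S ⊆ P, S.Nonempty → Disjoint S bd → K ≤ H2 (pureState v) S Q) :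
    ∃ h : Tensors ι bd → ℝ, Integrable h (tensorLaw ι bd) ∧
      ∫ t, h t ∂tensorLaw ι bd ≤ μ * hsSq N ∧
      ∀ t, ∃ W : Matrix (Cfg ι P) (Cfg ι D) ℂ, IsIsometry W ∧
        hsSq (N * cutTensor hD t * Wᵀ - N) ≤ h t := by
  set X := power (N * Nᴴ) (-(1 / 4)) * N with hX
  have hfl := integral_hsSq_fluctuation (P := tensorLaw ι bd)
    (fun S : Finset P => cutEquiv (ι := ι) hPQ (map_subtype_subset S)) (bulkSubsets P bd)
    (T := fun t => cutTensor hD t)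
    (fun i j => (integral_cutTensor_mul_conjTranspose hD hPD i j).1)
    (fun i j => (integral_cutTensor_mul_conjTranspose hD hPD i j).2)
    (fun p q => (integral_cutTensor_four hD hPD hPQ p q).1)
    (fun p q => (integral_cutTensor_four hD hPD hPQ p q).2) X
  refine ⟨fun t =>
      (μ * hsSq N + μ⁻¹ * hsSq (X * (cutTensor hD t * (cutTensor hD t)ᴴ - 1) * Xᴴ)) / 2,
    ((integrable_const _).add (hfl.1.const_mul _)).div_const 2, ?_, ?_⟩
  · have hle : ∫ t, hsSq (X * (cutTensor hD t * (cutTensor hD t)ᴴ - 1) * Xᴴ) ∂tensorLaw ι bd ≤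
        μ ^ 2 * hsSq N := by
      rw [hfl.2]
      have hterm : ∀ S ∈ bulkSubsets P bd,
          hsSq (regroup (cutEquiv hPQ (map_subtype_subset S)) X *
            (regroup (cutEquiv hPQ (map_subtype_subset S)) X)ᴴ) ≤ hsSq N * 2 ^ (-K) := by
        intro S hS
        rw [bulkSubsets, Finset.mem_filter] at hS
        refine hsSq_regroup_le_of_le_condH2 _ N ?_
        rw [← reducedBipartite_pureState hPQ (map_subtype_subset S) hN]
        refine hK _ (map_subtype_subset S)
          ((Finset.nonempty_iff_ne_empty.2 hS.2.1).map) ?_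
        rw [Finset.disjoint_left]
        intro x hx
        obtain ⟨y, hy, rfl⟩ := Finset.mem_map.1 hx
        exact hS.2.2 y hy
      refine (Finset.sum_le_card_nsmul _ _ _ hterm).trans ?_
      rw [nsmul_eq_mul, hμK]
      have hc : ((bulkSubsets P bd).card : ℝ) ≤ 2 ^ (bdᶜ).card := by
        exact_mod_cast card_bulkSubsets_le P bd
      have h0 : 0 ≤ hsSq N * 2 ^ (-K) :=
        mul_nonneg (hsSq_nonneg N) (Real.rpow_nonneg (by norm_num) _)
      calc _ ≤ 2 ^ (bdᶜ).card * (hsSq N * 2 ^ (-K)) := mul_le_mul_of_nonneg_right hc h0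
        _ = _ := by ring
    rw [integral_div, integral_add (integrable_const _) (hfl.1.const_mul _), integral_const,
      integral_const_mul, probReal_univ, one_smul]
    have h2 := mul_le_mul_of_nonneg_left hle (inv_nonneg.2 hμ.le)
    have h3 : μ⁻¹ * (μ ^ 2 * hsSq N) = μ * hsSq N := by field_simp
    linarith
  · intro t
    obtain ⟨W, hW, hle⟩ := exists_isometry_hsSq_sub_le_of_decoupled (card_cfg_le hD) N
      (cutTensor hD t) hμ
    exact ⟨W.map star, isIsometry_map_star hW, hle⟩

end Cuts

/-! ### The network state in terms of the two sides of a cut -/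

/-- Taking some of the coordinates from one sample and the others from an independent sample of a
product measure gives again a sample of the product measure. -/
lemma measurePreserving_piecewise {I : Type*} [Fintype I] {E : I → Type*}
    [∀ i, MeasurableSpace (E i)] (μ : ∀ i, Measure (E i)) [∀ i, IsProbabilityMeasure (μ i)]
    (p : I → Prop) [DecidablePred p] :
    MeasurePreserving (fun (z : (∀ i, E i) × (∀ i, E i)) i => if p i then z.1 i else z.2 i)
      ((Measure.pi μ).prod (Measure.pi μ)) (Measure.pi μ) := by
  have hm : Measurable (fun (z : (∀ i, E i) × (∀ i, E i)) i => if p i then z.1 i else z.2 i) := by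
    refine measurable_pi_iff.2 fun i => ?_
    by_cases h : p i <;> simp only [h, if_true, if_false] <;> fun_prop
  refine ⟨hm, (Measure.pi_eq fun s hs => ?_).symm⟩
  have hpre : (fun (z : (∀ i, E i) × (∀ i, E i)) i => if p i then z.1 i else z.2 i) ⁻¹'
      (Set.univ.pi s) = (Set.univ.pi fun i => if p i then s i else Set.univ) ×ˢ
        (Set.univ.pi fun i => if p i then Set.univ else s i) := by
    ext z
    simp only [Set.mem_preimage, Set.mem_univ_pi, Set.mem_prod]
    rw [← forall_and]
    refine forall_congr' fun i => ?_
    by_cases h : p i <;> simp [h]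
  rw [Measure.map_apply hm (MeasurableSet.univ_pi hs), hpre, Measure.prod_prod, Measure.pi_pi,
    Measure.pi_pi, ← Finset.prod_mul_distrib]
  refine Finset.prod_congr rfl fun i _ => ?_
  by_cases h : p i <;> simp [h]

lemma hsSq_mul_transpose {m n g : Type*} [Fintype m] [Fintype n] [Fintype g] [DecidableEq n]
    (X : Matrix m n ℂ) {W : Matrix g n ℂ} (hW : IsIsometry W) : hsSq (X * Wᵀ) = hsSq X := by
  have h : Wᵀ = (W.map star)ᴴ := by ext i j; simp
  rw [h, hsSq_mul_of_isometry X (isIsometry_map_star hW)]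

/-- The same tensor with three indices, read as a matrix whose columns are labelled by `h` instead
of `g`. It switches between the two sides of a cut; the reference index `κ` stays with the rows. -/
def exchange {g h κ : Type*} (M : Matrix (h × κ) g ℂ) : Matrix (g × κ) h ℂ :=
  fun p k => M (k, p.2) p.1

lemma hsSq_exchange {g h κ : Type*} [Fintype g] [Fintype h] [Fintype κ]
    (M : Matrix (h × κ) g ℂ) : hsSq (exchange M) = hsSq M := by
  simp only [hsSq, exchange, Fintype.sum_prod_type]
  rw [Finset.sum_comm' (s' := fun _ => Finset.univ) (t' := Finset.univ) (by simp)]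
  conv_rhs => rw [Finset.sum_comm]
  refine Finset.sum_congr rfl fun r _ => ?_
  rw [Finset.sum_comm]

section Network

variable {V : Type*} [Fintype V] [DecidableEq V] {ι : V → Type*} {κ : Type*}
  {bd A Γ : Finset V}

/-- The factorization `H_V = H_S ⊗ H_{Sᶜ}` on the level of basis labels. -/
def glueEquiv (S : Finset V) : Cfg ι S × Cfg ι Sᶜ ≃ ∀ x, ι x where
  toFun p := glue p.1 p.2
  invFun f := (S.restrict f, Sᶜ.restrict f)
  left_inv p := by
    ext x
    · simp [glue]
    · have := Finset.mem_compl.1 x.2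
      simp [glue, this]
  right_inv f := by
    ext x
    by_cases h : x ∈ S <;> simp [glue, h]

lemma glue_restrict (S : Finset V) (f : ∀ x, ι x) : glue (S.restrict f) (Sᶜ.restrict f) = f :=
  (glueEquiv S).apply_symm_apply f

lemma restrict_glue (S : Finset V) (i : Cfg ι S) (c : Cfg ι Sᶜ) : S.restrict (glue i c) = i :=
  congrArg Prod.fst ((glueEquiv S).symm_apply_apply (i, c))

lemma restrict_compl_glue (S : Finset V) (i : Cfg ι S) (c : Cfg ι Sᶜ) :
    Sᶜ.restrict (glue i c) = c :=
  congrArg Prod.snd ((glueEquiv S).symm_apply_apply (i, c))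

variable [∀ x, Fintype (ι x)]

lemma sum_eq_sum_glue (S : Finset V) {M : Type*} [AddCommMonoid M] (F : (∀ x, ι x) → M) :
    ∑ f, F f = ∑ i : Cfg ι S, ∑ c : Cfg ι Sᶜ, F (glue i c) := by
  rw [← (glueEquiv S).sum_comp, Fintype.sum_prod_type]
  rfl

/-- The unnormalized vector of the tensor network state with background state `|v⟩⟨v|`: the
contraction of `v` with the tensors at the bulk vertices. -/
def networkVec (v : Full ι κ → ℂ) (t : Tensors ι bd) : Cfg ι bd × κ → ℂ :=
  fun q => ∑ c : Cfg ι bdᶜ, (∏ x : (bdᶜ : Finset V), star (t x (c x))) * v (glue q.1 c, q.2)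

variable [∀ x, DecidableEq (ι x)] [Fintype κ] [DecidableEq κ]

lemma networkState_pureState (v : Full ι κ → ℂ) (t : Tensors ι bd) :
    networkState bd (pureState v) t = pureState (networkVec v t) := by
  ext ⟨q, r⟩ ⟨q', r'⟩
  have hb : ∀ (i : Cfg ι bd) (c : Cfg ι bdᶜ) (x : (bdᶜ : Finset V)), glue i c x.1 = c x :=
    fun i c x => congrFun (restrict_compl_glue bd i c) x
  have h : ∀ c : Cfg ι bdᶜ, (projector bd t * pureState v : Matrix (Full ι κ) (Full ι κ) ℂ)
      (glue q c, r) (glue q' c, r') =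
      (∏ x : (bdᶜ : Finset V), t x (c x)) * networkVec v t (q, r) * star (v (glue q' c, r')) := by
    intro c
    simp only [Matrix.mul_apply, pureState, Matrix.vecMulVec_apply, Pi.star_apply, projector]
    rw [Fintype.sum_prod_type_right, Fintype.sum_eq_single r, sum_eq_sum_glue bd,
      Fintype.sum_eq_single q]
    · simp only [restrict_glue, and_self, if_true, hb, Finset.prod_mul_distrib, networkVec,
        Finset.mul_sum, Finset.sum_mul]
      refine Finset.sum_congr rfl fun d _ => ?_
      ring
    · intro i hi
      simp [restrict_glue, Ne.symm hi]
    · intro s hs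
      simp [Ne.symm hs]
  simp only [networkState, reduced, h]
  change _ = networkVec v t (q, r) * star (networkVec v t (q', r'))
  conv_rhs => rw [networkVec, networkVec, star_sum, Finset.mul_sum]
  refine Finset.sum_congr rfl fun c _ => ?_
  rw [star_mul', star_prod]
  simp only [star_star, networkVec]
  ring

lemma recoveryMap_conj_pureState (hA : A ⊆ bd) (VA : Matrix (Cfg ι Γ) (Cfg ι A) ℂ)
    (VB : Matrix (Cfg ι Γᶜ) (Cfg ι (bd \ A)) ℂ) (w : Cfg ι bd × κ → ℂ) :
    (recoveryMap hA Γ VA VB : Matrix (Full ι κ) (Cfg ι bd × κ) ℂ) * pureState w *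
      (recoveryMap hA Γ VA VB : Matrix (Full ι κ) (Cfg ι bd × κ) ℂ)ᴴ =
    pureState ((recoveryMap hA Γ VA VB : Matrix (Full ι κ) (Cfg ι bd × κ) ℂ) *ᵥ w) := by
  rw [pureState, pureState, Matrix.mul_vecMulVec, Matrix.vecMulVec_mul, Matrix.star_mulVec]

/-- The coefficients of `v` as a matrix from `H_Γ` to `H_{Γᶜ} ⊗ H_R`. -/
def cutMatrix (Γ : Finset V) (v : Full ι κ → ℂ) : Matrix (Cfg ι Γᶜ × κ) (Cfg ι Γ) ℂ :=
  fun k g => v (glue g k.1, k.2)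

lemma cutTensor_mul_transpose {D P : Finset V} (hD : D ⊆ P) (t : Tensors ι bd)
    (W : Matrix (Cfg ι P) (Cfg ι D) ℂ) (g' g : Cfg ι P) :
    (cutTensor hD t * Wᵀ) g' g =
      (∏ x : P, star (amp t x (g' x))) * W g (Finset.restrict₂ (π := ι) hD g') := by
  simp [Matrix.mul_apply, cutTensor]

/-- Along the cut, recovery acts on each side as `T ↦ T * Vᵀ`. -/
lemma recoveryMap_mulVec_networkVec (hA : A ⊆ bd) (hAΓ : A ⊆ Γ) (hBΓ : bd \ A ⊆ Γᶜ)
    (VA : Matrix (Cfg ι Γ) (Cfg ι A) ℂ) (VB : Matrix (Cfg ι Γᶜ) (Cfg ι (bd \ A)) ℂ)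
    (v : Full ι κ → ℂ) (t : Tensors ι bd) (p : Full ι κ) :
    ((recoveryMap hA Γ VA VB : Matrix (Full ι κ) (Cfg ι bd × κ) ℂ) *ᵥ networkVec v t) p =
      (exchange (cutMatrix Γ v * cutTensor hAΓ t * VAᵀ) * cutTensor hBΓ t * VBᵀ)
        (Γ.restrict p.1, p.2) (Γᶜ.restrict p.1) := by
  obtain ⟨f, r⟩ := p
  set F : (∀ x, ι x) → ℂ := fun f' =>
    VA (Γ.restrict f) (A.restrict f') * VB (Γᶜ.restrict f) ((bd \ A).restrict f') *
      ((∏ x, star (amp t x (f' x))) * v (f', r)) with hF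
  have hamp : ∀ (q : Cfg ι bd) (c : Cfg ι bdᶜ), ∏ x, star (amp t x (glue q c x)) =
      ∏ x : (bdᶜ : Finset V), star (t x (c x)) := by
    intro q c
    rw [← Finset.prod_subset (Finset.subset_univ bdᶜ), ← Finset.prod_coe_sort]
    · refine Finset.prod_congr rfl fun x _ => ?_
      have hx := Finset.mem_compl.1 x.2
      rw [show glue q c x.1 = c x from congrFun (restrict_compl_glue bd q c) x, amp, dif_neg hx]
    · intro x _ hx
      rw [Finset.mem_compl, not_not] at hx
      simp [amp, hx]
  -- Both sides are the sum of `F` over all labels, split along `bd` on the left and along `Γ` on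
  -- the right.
  have hL : ((recoveryMap hA Γ VA VB : Matrix (Full ι κ) (Cfg ι bd × κ) ℂ) *ᵥ networkVec v t)
      (f, r) = ∑ f', F f' := by
    rw [sum_eq_sum_glue bd]
    simp only [Matrix.mulVec, dotProduct, recoveryMap]
    rw [Fintype.sum_prod_type]
    refine Finset.sum_congr rfl fun q _ => ?_
    rw [Fintype.sum_eq_single r fun s hs => by simp [Ne.symm hs]]
    simp only [if_true, mul_one, networkVec, Finset.mul_sum]
    refine Finset.sum_congr rfl fun c _ => ?_
    rw [hF]
    simp only
    rw [hamp, show A.restrict (glue q c) = Finset.restrict₂ (π := ι) hA q by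
        conv_rhs => rw [← restrict_glue bd q c]
        rfl,
      show (bd \ A).restrict (glue q c) =
          Finset.restrict₂ (π := ι) Finset.sdiff_subset q by
        conv_rhs => rw [← restrict_glue bd q c]
        rfl]
  have hprod : ∀ (g : Cfg ι Γ) (h : Cfg ι Γᶜ), ∏ x, star (amp t x (glue g h x)) =
      (∏ x : Γ, star (amp t x (g x))) * ∏ x : (Γᶜ : Finset V), star (amp t x (h x)) := by
    intro g h
    rw [← Finset.prod_mul_prod_compl Γ, ← Finset.prod_coe_sort Γ, ← Finset.prod_coe_sort Γᶜ]
    congr 1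
    · refine Finset.prod_congr rfl fun x _ => ?_
      rw [show glue g h x.1 = g x from congrFun (restrict_glue Γ g h) x]
    · refine Finset.prod_congr rfl fun x _ => ?_
      rw [show glue g h x.1 = h x from congrFun (restrict_compl_glue Γ g h) x]
  rw [hL, sum_eq_sum_glue Γ, Finset.sum_comm, Matrix.mul_assoc, Matrix.mul_assoc, Matrix.mul_apply]
  refine Finset.sum_congr rfl fun h _ => ?_
  rw [cutTensor_mul_transpose, exchange, Matrix.mul_apply, Finset.sum_mul]
  refine Finset.sum_congr rfl fun g _ => ?_
  rw [cutTensor_mul_transpose, hF, cutMatrix]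
  simp only
  rw [hprod, show A.restrict (glue g h) = Finset.restrict₂ (π := ι) hAΓ g by
        conv_rhs => rw [← restrict_glue Γ g h]
        rfl,
      show (bd \ A).restrict (glue g h) = Finset.restrict₂ (π := ι) hBΓ h by
        conv_rhs => rw [← restrict_compl_glue Γ g h]
        rfl]
  ring

lemma nSq_eq_hsSq (Γ : Finset V) (M : Matrix (Cfg ι Γ × κ) (Cfg ι Γᶜ) ℂ) :
    nSq (fun p : Full ι κ => M (Γ.restrict p.1, p.2) (Γᶜ.restrict p.1)) = hsSq M := by
  simp only [nSq, hsSq, Fintype.sum_prod_type]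
  rw [sum_eq_sum_glue Γ]
  refine Finset.sum_congr rfl fun g _ => ?_
  rw [Finset.sum_comm]
  simp only [restrict_glue, restrict_compl_glue]

/-! ### Attainment and continuity of the minimal recovery error -/

lemma continuous_networkState (φ : Matrix (Full ι κ) (Full ι κ) ℂ) :
    Continuous fun t : Tensors ι bd => networkState bd φ t := by
  refine continuous_matrix fun p q => ?_
  simp only [networkState, reduced, Matrix.mul_apply, projector]
  refine continuous_finsetSum _ fun c _ => continuous_finsetSum _ fun f _ =>
    Continuous.mul ?_ continuous_const
  split_ifs <;> fun_prop

/-- The recovery error for the pair `p` of isometries, as a function defined for all pairs of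
matrices. -/
def recoveryError (hA : A ⊆ bd) (Γ : Finset V) (φ : Matrix (Full ι κ) (Full ι κ) ℂ)
    (ρ : Matrix (Cfg ι bd × κ) (Cfg ι bd × κ) ℂ)
    (p : Matrix (Cfg ι Γ) (Cfg ι A) ℂ × Matrix (Cfg ι Γᶜ) (Cfg ι (bd \ A)) ℂ) : ℝ :=
  traceNorm ((recoveryMap hA Γ p.1 p.2 : Matrix (Full ι κ) (Cfg ι bd × κ) ℂ) * ρ *
      (recoveryMap hA Γ p.1 p.2 : Matrix (Full ι κ) (Cfg ι bd × κ) ℂ)ᴴ - φ)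

lemma continuous_recoveryError {X : Type*} [TopologicalSpace X] (hA : A ⊆ bd)
    (φ : Matrix (Full ι κ) (Full ι κ) ℂ) {ρ : X → Matrix (Cfg ι bd × κ) (Cfg ι bd × κ) ℂ}
    {p : X → Matrix (Cfg ι Γ) (Cfg ι A) ℂ × Matrix (Cfg ι Γᶜ) (Cfg ι (bd \ A)) ℂ}
    (hρ : Continuous ρ) (hp : Continuous p) :
    Continuous fun x => recoveryError hA Γ φ (ρ x) (p x) := by
  have hR : Continuous fun x =>
      (recoveryMap hA Γ (p x).1 (p x).2 : Matrix (Full ι κ) (Cfg ι bd × κ) ℂ) := by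
    refine continuous_matrix fun a b => ?_
    simp only [recoveryMap]
    have h1 : Continuous fun x =>
        (p x).1 (Γ.restrict a.1) (Finset.restrict₂ (π := ι) hA b.1) :=
      (continuous_fst.comp hp).matrix_elem _ _
    have h2 : Continuous fun x =>
        (p x).2 (Γᶜ.restrict a.1) (Finset.restrict₂ (π := ι) Finset.sdiff_subset b.1) :=
      (continuous_snd.comp hp).matrix_elem _ _
    exact (h1.mul h2).mul continuous_const
  unfold recoveryError
  exact continuous_traceNorm.comp
    (((hR.matrix_mul hρ).matrix_mul hR.matrix_conjTranspose).sub continuous_const)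

lemma recoveryErrors_eq_image (hA : A ⊆ bd) (φ : Matrix (Full ι κ) (Full ι κ) ℂ)
    (ρ : Matrix (Cfg ι bd × κ) (Cfg ι bd × κ) ℂ) :
    recoveryErrors hA Γ φ ρ = recoveryError hA Γ φ ρ ''
      ({W | IsIsometry W} ×ˢ {W | IsIsometry W}) := by
  ext e
  constructor
  · rintro ⟨VA, VB, h1, h2, rfl⟩
    exact ⟨(VA, VB), ⟨h1, h2⟩, rfl⟩
  · rintro ⟨⟨VA, VB⟩, ⟨h1, h2⟩, rfl⟩
    exact ⟨VA, VB, h1, h2, rfl⟩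

lemma isCompact_isometryPairs (A B Γ Γ' : Finset V) :
    IsCompact ({W | IsIsometry W} ×ˢ {W | IsIsometry W} :
      Set (Matrix (Cfg ι Γ) (Cfg ι A) ℂ × Matrix (Cfg ι Γ') (Cfg ι B) ℂ)) :=
  IsCompact.prod isCompact_setOf_isIsometry isCompact_setOf_isIsometry

lemma isLeast_minRecoveryError [∀ x, Nonempty (ι x)] (hA : A ⊆ bd) (hAΓ : A ⊆ Γ)
    (hBΓ : bd \ A ⊆ Γᶜ) (φ : Matrix (Full ι κ) (Full ι κ) ℂ)
    (ρ : Matrix (Cfg ι bd × κ) (Cfg ι bd × κ) ℂ) :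
    IsLeast (recoveryErrors hA Γ φ ρ) (minRecoveryError hA Γ φ ρ) := by
  obtain ⟨VA, hVA⟩ := exists_isIsometry (card_cfg_le (ι := ι) hAΓ)
  obtain ⟨VB, hVB⟩ := exists_isIsometry (card_cfg_le (ι := ι) hBΓ)
  have hne : (recoveryErrors hA Γ φ ρ).Nonempty := ⟨_, VA, VB, hVA, hVB, rfl⟩
  rw [minRecoveryError]
  refine IsCompact.isLeast_sInf ?_ hne
  rw [recoveryErrors_eq_image]
  have hc : Continuous (recoveryError hA Γ φ ρ) :=
    continuous_recoveryError hA φ continuous_const continuous_id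
  exact (isCompact_isometryPairs A (bd \ A) Γ Γᶜ).image hc

lemma continuous_minRecoveryError (hA : A ⊆ bd) (φ : Matrix (Full ι κ) (Full ι κ) ℂ) :
    Continuous fun t : Tensors ι bd => minRecoveryError hA Γ φ (networkState bd φ t) := by
  simp only [minRecoveryError, recoveryErrors_eq_image]
  have hc : Continuous fun x : Tensors ι bd ×
      (Matrix (Cfg ι Γ) (Cfg ι A) ℂ × Matrix (Cfg ι Γᶜ) (Cfg ι (bd \ A)) ℂ) =>
      recoveryError hA Γ φ (networkState bd φ x.1) x.2 :=
    continuous_recoveryError hA φ ((continuous_networkState φ).comp continuous_fst) continuous_snd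
  exact (isCompact_isometryPairs A (bd \ A) Γ Γᶜ).continuous_sInf
    (f := fun t p => recoveryError hA Γ φ (networkState bd φ t) p) hc

end Network

/-! ### Combining the two sides -/

section Recovery

variable {V : Type*} [Fintype V] [DecidableEq V] {ι : V → Type*} {κ : Type*}
  {bd A Γ : Finset V}

/-- The tensors that agree with `z.1` at the vertices of `Γ` and with `z.2` elsewhere. -/
def splice (Γ : Finset V) (z : Tensors ι bd × Tensors ι bd) : Tensors ι bd :=
  fun x => if x.1 ∈ Γ then z.1 x else z.2 x

lemma cutTensor_congr [∀ x, DecidableEq (ι x)] {D P : Finset V} (hD : D ⊆ P)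
    {t t' : Tensors ι bd} (h : ∀ x : (bdᶜ : Finset V), x.1 ∈ P → t x = t' x) :
    cutTensor hD t = cutTensor hD t' := by
  ext g a
  have hp : ∀ x : P, amp t x (g x) = amp t' x (g x) := by
    intro x
    by_cases hx : x.1 ∈ bd
    · simp [amp, hx]
    · simp only [amp, hx, dif_neg, not_false_eq_true]
      rw [h ⟨x.1, Finset.mem_compl.2 hx⟩ x.2]
  simp only [cutTensor, hp]

variable [∀ x, Fintype (ι x)] [∀ x, DecidableEq (ι x)]

/-- The tensors on the two sides of a cut are independent. -/
lemma measurePreserving_splice (Γ : Finset V) :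
    MeasurePreserving (splice (ι := ι) (bd := bd) Γ)
      ((tensorLaw ι bd).prod (tensorLaw ι bd)) (tensorLaw ι bd) :=
  measurePreserving_piecewise (fun x : (bdᶜ : Finset V) =>
    Measure.pi fun _ : ι x => stdComplexGaussian) fun x => x.1 ∈ Γ

variable [Fintype κ] [DecidableEq κ]

lemma nSq_eq_hsSq_cutMatrix (Γ : Finset V) (v : Full ι κ → ℂ) :
    nSq v = hsSq (cutMatrix Γ v) := by
  rw [← hsSq_exchange, ← nSq_eq_hsSq]
  simp only [exchange, cutMatrix, glue_restrict]

/-- The recovery error for any pair of isometries, when the tensors on the side of `Γ` come from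
`z.1` and those on the other side from `z.2`. The error of the first side appears contracted with
the tensors of the second side. -/
lemma minRecoveryError_splice_le (hA : A ⊆ bd) (hAΓ : A ⊆ Γ) (hBΓ : bd \ A ⊆ Γᶜ)
    {v : Full ι κ → ℂ} {c : ℝ} (hc : 0 < c) {z : Tensors ι bd × Tensors ι bd}
    {W₁ : Matrix (Cfg ι Γ) (Cfg ι A) ℂ} {W₂ : Matrix (Cfg ι Γᶜ) (Cfg ι (bd \ A)) ℂ}
    (h₁ : IsIsometry W₁) (h₂ : IsIsometry W₂) :
    minRecoveryError hA Γ (pureState v) (networkState bd (pureState v) (splice Γ z)) ≤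
      c * (hsSq (exchange (cutMatrix Γ v * cutTensor hAΓ z.1 * W₁ᵀ) * cutTensor hBΓ z.2) +
        hsSq (cutMatrix Γ v)) +
      c⁻¹ * (2 * (hsSq (exchange (cutMatrix Γ v * cutTensor hAΓ z.1 * W₁ᵀ - cutMatrix Γ v) *
          cutTensor hBΓ z.2) +
        hsSq (exchange (cutMatrix Γ v) * cutTensor hBΓ z.2 * W₂ᵀ - exchange (cutMatrix Γ v)))) := by
  set N := cutMatrix Γ v with hN
  set y := (recoveryMap hA Γ W₁ W₂ : Matrix (Full ι κ) (Cfg ι bd × κ) ℂ) *ᵥ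
    networkVec v (splice Γ z) with hy
  have hs₁ : cutTensor hAΓ (splice Γ z) = cutTensor hAΓ z.1 :=
    cutTensor_congr hAΓ fun x hx => by simp [splice, hx]
  have hs₂ : cutTensor hBΓ (splice Γ z) = cutTensor hBΓ z.2 :=
    cutTensor_congr hBΓ fun x hx => by simp [splice, Finset.mem_compl.1 hx]
  set X : Matrix (Cfg ι Γᶜ × κ) (Cfg ι Γ) ℂ := N * cutTensor hAΓ z.1 * W₁ᵀ with hX
  set Y : Matrix (Cfg ι Γ × κ) (Cfg ι Γᶜ) ℂ := exchange X * cutTensor hBΓ z.2 * W₂ᵀ with hY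
  have hyY : y = fun p : Full ι κ => Y (Γ.restrict p.1, p.2) (Γᶜ.restrict p.1) := by
    funext p
    rw [hy, recoveryMap_mulVec_networkVec hA hAΓ hBΓ, hs₁, hs₂]
  have hvN : v = fun p : Full ι κ => exchange N (Γ.restrict p.1, p.2) (Γᶜ.restrict p.1) := by
    funext p
    simp only [hN, exchange, cutMatrix, glue_restrict]
  have hyv : nSq (y - v) = hsSq (Y - exchange N) := by
    rw [← nSq_eq_hsSq]
    congr 1
    funext p
    rw [Pi.sub_apply, Matrix.sub_apply, congrFun hyY p, congrFun hvN p]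
  have hYN : Y - exchange N = exchange (X - N) * cutTensor hBΓ z.2 * W₂ᵀ +
      (exchange N * cutTensor hBΓ z.2 * W₂ᵀ - exchange N) := by
    have hsub : exchange (X - N) = exchange X - exchange N := rfl
    rw [hsub, Matrix.sub_mul, Matrix.sub_mul]
    abel
  have hbdd : BddBelow (recoveryErrors hA Γ (pureState v)
      (networkState bd (pureState v) (splice Γ z))) := by
    refine ⟨0, ?_⟩
    rintro e ⟨_, _, _, _, rfl⟩
    exact traceNorm_nonneg _
  have hmem := csInf_le hbdd ⟨W₁, W₂, h₁, h₂, rfl⟩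
  rw [networkState_pureState, recoveryMap_conj_pureState] at hmem
  rw [minRecoveryError, networkState_pureState]
  refine hmem.trans ((traceNorm_pureState_sub_le y v hc).trans ?_)
  have hny : nSq y = hsSq (exchange X * cutTensor hBΓ z.2) := by
    rw [hyY, nSq_eq_hsSq, hY, hsSq_mul_transpose _ h₂]
  rw [hny, nSq_eq_hsSq_cutMatrix Γ v, hyv, hYN]
  gcongr
  refine (hsSq_add_le _ _).trans_eq ?_
  rw [hsSq_mul_transpose _ h₂]

end Recovery

/-- A bound on an expectation obtained by integrating over two independent parts of the randomness
one after the other. Only a pointwise majorant `F` of each section is required to be integrable. -/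
lemma integrable_and_integral_le_of_measurePreserving_prod {Ω : Type*} [MeasurableSpace Ω]
    {P : Measure Ω} [SFinite P] {m : Ω × Ω → Ω} (hm : MeasurePreserving m (P.prod P) P)
    {e ψ : Ω → ℝ} (he : Measurable e) (h0 : ∀ t, 0 ≤ e t) (hψ : Integrable ψ P)
    (h : ∀ t, ∃ F : Ω → ℝ, Integrable F P ∧ (∀ s, e (m (t, s)) ≤ F s) ∧ ∫ s, F s ∂P ≤ ψ t) :
    Integrable e P ∧ ∫ t, e t ∂P ≤ ∫ t, ψ t ∂P := by
  have hψ0 : ∀ t, 0 ≤ ψ t := fun t => by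
    obtain ⟨F, -, hF, hFψ⟩ := h t
    exact (integral_nonneg fun s => (h0 _).trans (hF s)).trans hFψ
  have hle : ∫⁻ t, ENNReal.ofReal (e t) ∂P ≤ ENNReal.ofReal (∫ t, ψ t ∂P) := by
    rw [← hm.lintegral_comp he.ennreal_ofReal,
      lintegral_prod (fun z => ENNReal.ofReal (e (m z)))
        (he.ennreal_ofReal.comp hm.measurable).aemeasurable,
      ofReal_integral_eq_lintegral_ofReal hψ (ae_of_all _ hψ0)]
    refine lintegral_mono fun t => ?_
    obtain ⟨F, hFi, hF, hFψ⟩ := h t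
    calc ∫⁻ s, ENNReal.ofReal (e (m (t, s))) ∂P ≤ ∫⁻ s, ENNReal.ofReal (F s) ∂P :=
          lintegral_mono fun s => ENNReal.ofReal_le_ofReal (hF s)
      _ = ENNReal.ofReal (∫ s, F s ∂P) :=
          (ofReal_integral_eq_lintegral_ofReal hFi
            (ae_of_all _ fun s => (h0 _).trans (hF s))).symm
      _ ≤ ENNReal.ofReal (ψ t) := ENNReal.ofReal_le_ofReal hFψ
  have hint : Integrable e P :=
    ⟨he.aestronglyMeasurable, by
      rw [hasFiniteIntegral_iff_ofReal (ae_of_all _ h0)]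
      exact hle.trans_lt ENNReal.ofReal_lt_top⟩
  refine ⟨hint, ?_⟩
  rw [← ofReal_integral_eq_lintegral_ofReal hint (ae_of_all _ h0)] at hle
  exact (ENNReal.ofReal_le_ofReal_iff (integral_nonneg hψ0)).1 hle

lemma integrable_and_integral_combination {Ω : Type*} [MeasurableSpace Ω] {P : Measure Ω}
    {f f' g g' : Ω → ℝ} (hf : Integrable f P) (hf' : Integrable f' P) (hg : Integrable g P)
    (hg' : Integrable g' P) (c d : ℝ) :
    Integrable (fun t => c * (f t + f' t) + d * (2 * (g t + g' t))) P ∧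
    ∫ t, c * (f t + f' t) + d * (2 * (g t + g' t)) ∂P =
      c * (∫ t, f t ∂P + ∫ t, f' t ∂P) + d * (2 * (∫ t, g t ∂P + ∫ t, g' t ∂P)) := by
  have h1 : Integrable (fun t => c * (f t + f' t)) P := (hf.add hf').const_mul c
  have h2 : Integrable (fun t => d * (2 * (g t + g' t))) P :=
    ((hg.add hg').const_mul 2).const_mul d
  refine ⟨h1.add h2, ?_⟩
  rw [integral_add h1 h2, integral_const_mul, integral_const_mul, integral_const_mul,
    integral_add hf hf', integral_add hg hg']

section Recovery

variable {V : Type*} [Fintype V] [DecidableEq V] {ι : V → Type*} {κ : Type*}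
  {bd A Γ : Finset V} [∀ x, Fintype (ι x)] [∀ x, DecidableEq (ι x)] [∀ x, Nonempty (ι x)]
  [Fintype κ] [DecidableEq κ]

/-- The expected recovery error for the weights `s₁` and `s₂`, which stand for
`2 ^ ((|V_b| - K₁) / 4)` and `2 ^ ((|V_b| - K₂) / 4)`. -/
theorem integrable_minRecoveryError_and_integral_le (hA : A ⊆ bd) (hΓ : IsCut bd A Γ)
    {v : Full ι κ → ℂ} {K₁ K₂ : ℝ}
    (hK₁ : ∀ Δ : Finset V, IsCut bd A Δ → Δ ⊂ Γ → K₁ ≤ H2 (pureState v) (Γ \ Δ) Γᶜ)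
    (hK₂ : ∀ Δ : Finset V, IsCut bd A Δ → Γ ⊂ Δ → K₂ ≤ H2 (pureState v) (Δ \ Γ) Γ)
    {s₁ s₂ : ℝ} (hs₁ : 0 < s₁) (hs₂ : 0 < s₂)
    (hsK₁ : (s₁ ^ 2) ^ 2 = 2 ^ (bdᶜ).card * 2 ^ (-K₁))
    (hsK₂ : (s₂ ^ 2) ^ 2 = 2 ^ (bdᶜ).card * 2 ^ (-K₂)) :
    Integrable (fun t => minRecoveryError hA Γ (pureState v) (networkState bd (pureState v) t))
      (tensorLaw ι bd) ∧
    ∫ t, minRecoveryError hA Γ (pureState v) (networkState bd (pureState v) t)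
      ∂(tensorLaw ι bd) ≤ 4 * (s₁ + s₂) * nSq v := by
  have hΓ' : Γ ∩ bd = A := hΓ
  have hAΓ : A ⊆ Γ := hΓ' ▸ Finset.inter_subset_left
  have hB : Γᶜ ∩ bd = bd \ A := by
    rw [← hΓ']; ext x; simp only [Finset.mem_inter, Finset.mem_compl, Finset.mem_sdiff]; tauto
  have hBΓ : bd \ A ⊆ Γᶜ := hB ▸ Finset.inter_subset_left
  set N := cutMatrix Γ v with hN
  have hn : nSq v = hsSq N := nSq_eq_hsSq_cutMatrix Γ v
  obtain ⟨h₁, hi₁, hb₁, hW₁⟩ := exists_oneSided_recovery (bd := bd) (v := v) (N := N)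
    (Q := Γᶜ) hAΓ hΓ' (fun x => Finset.mem_compl)
    (fun f r => by simp only [hN, cutMatrix, glue_restrict]) (sq_pos_of_pos hs₁) hsK₁
    (fun S hS hne hd => by
      have hsd : Γ \ (Γ \ S) = S := by simpa using hS
      rw [← hsd]
      -- The cut `Δ = Γ \ S`.
      refine hK₁ _ ?_ (Finset.sdiff_ssubset hS hne)
      rw [IsCut, ← hΓ']
      ext x
      have : x ∈ S → x ∉ bd := fun h => Finset.disjoint_left.1 hd h
      simp only [Finset.mem_inter, Finset.mem_sdiff]
      tauto)
  obtain ⟨h₂, hi₂, hb₂, hW₂⟩ := exists_oneSided_recovery (bd := bd) (v := v) (N := exchange N)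
    (Q := Γ) hBΓ hB (fun x => by simp)
    (fun f r => by simp only [hN, exchange, cutMatrix, glue_restrict]) (sq_pos_of_pos hs₂) hsK₂
    (fun S hS hne hd => by
      have hdj : Disjoint Γ S := by
        rw [Finset.disjoint_left]
        exact fun x hx hxS => Finset.mem_compl.1 (hS hxS) hx
      have hsd : (Γ ∪ S) \ Γ = S := Finset.union_sdiff_cancel_left hdj
      rw [← hsd]
      -- The cut `Δ = Γ ∪ S`.
      refine hK₂ _ ?_ ?_
      · rw [IsCut, ← hΓ']
        ext x
        have : x ∈ S → x ∉ bd := fun h => Finset.disjoint_left.1 hd h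
        simp only [Finset.mem_inter, Finset.mem_union]
        tauto
      · refine Finset.ssubset_iff_subset_ne.2 ⟨Finset.subset_union_left, fun h => ?_⟩
        obtain ⟨x, hx⟩ := hne
        have hxΓ : x ∈ Γ := by rw [h]; exact Finset.mem_union_right _ hx
        exact Finset.disjoint_left.1 hdj hxΓ hx)
  rw [hsSq_exchange] at hb₂
  -- The squared errors have mean at most `c ^ 2 * nSq v`, which makes `c` the right weight in
  -- `minRecoveryError_splice_le`.
  set c := s₁ + s₂ with hc
  have hc0 : 0 < c := add_pos hs₁ hs₂
  set I₂ := ∫ t, h₂ t ∂tensorLaw ι bd with hI₂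
  have hT₁ : ∀ X : Matrix (Cfg ι Γᶜ × κ) (Cfg ι Γ) ℂ, _ := integral_hsSq_mul
    (P := tensorLaw ι bd) (T := fun t => cutTensor hAΓ t)
    (fun i j => (integral_cutTensor_mul_conjTranspose hAΓ hΓ' i j).1)
    (fun i j => (integral_cutTensor_mul_conjTranspose hAΓ hΓ' i j).2)
  have hT₂ : ∀ X : Matrix (Cfg ι Γ × κ) (Cfg ι Γᶜ) ℂ, _ := integral_hsSq_mul
    (P := tensorLaw ι bd) (T := fun t => cutTensor hBΓ t)
    (fun i j => (integral_cutTensor_mul_conjTranspose hBΓ hB i j).1)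
    (fun i j => (integral_cutTensor_mul_conjTranspose hBΓ hB i j).2)
  have hi := integrable_and_integral_combination (hT₁ N).1
    (integrable_const (μ := tensorLaw ι bd) (hsSq N)) hi₁ (integrable_const I₂) c c⁻¹
  have key := integrable_and_integral_le_of_measurePreserving_prod
    (measurePreserving_splice (ι := ι) (bd := bd) Γ)
    (continuous_minRecoveryError (Γ := Γ) hA (pureState v)).measurable
    (fun t => by
      obtain ⟨_, _, _, _, h⟩ := (isLeast_minRecoveryError hA hAΓ hBΓ (pureState v)
        (networkState bd (pureState v) t)).1
      rw [h]; exact traceNorm_nonneg _) hi.1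
    (fun t => by
      obtain ⟨W₁, hW, hle⟩ := hW₁ t
      have hF := integrable_and_integral_combination
        (hT₂ (exchange (N * cutTensor hAΓ t * W₁ᵀ))).1
        (integrable_const (μ := tensorLaw ι bd) (hsSq N))
        (hT₂ (exchange (N * cutTensor hAΓ t * W₁ᵀ - N))).1 hi₂ c c⁻¹
      refine ⟨_, hF.1, fun s => ?_, ?_⟩
      · obtain ⟨W₂, hW', hle'⟩ := hW₂ s
        refine (minRecoveryError_splice_le hA hAΓ hBΓ hc0 hW hW').trans ?_
        gcongr
      · rw [hF.2, (hT₂ _).2, (hT₂ _).2, hsSq_exchange, hsSq_exchange,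
          hsSq_mul_transpose _ hW, integral_const, probReal_univ, one_smul]
        gcongr)
  refine ⟨key.1, key.2.trans ?_⟩
  rw [hi.2, (hT₁ _).2, integral_const, integral_const, probReal_univ, one_smul, one_smul, hn]
  have hn0 := hsSq_nonneg N
  have hsum : (∫ t, h₁ t ∂tensorLaw ι bd) + I₂ ≤ c ^ 2 * hsSq N := by
    have : (s₁ ^ 2 + s₂ ^ 2) * hsSq N ≤ c ^ 2 * hsSq N := by
      refine mul_le_mul_of_nonneg_right ?_ hn0
      rw [hc]; nlinarith [mul_pos hs₁ hs₂]
    linarith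
  calc c * (hsSq N + hsSq N) + c⁻¹ * (2 * ((∫ t, h₁ t ∂tensorLaw ι bd) + I₂))
      ≤ c * (hsSq N + hsSq N) + c⁻¹ * (2 * (c ^ 2 * hsSq N)) := by gcongr
    _ = 4 * c * hsSq N := by field_simp; ring

lemma trace_re_pureState {n : Type*} [Fintype n] (v : n → ℂ) :
    (pureState v).trace.re = nSq v := by
  simp only [pureState, Matrix.trace, Matrix.diag, Matrix.vecMulVec_apply, nSq, Complex.re_sum,
    Pi.star_apply]
  refine Finset.sum_congr rfl fun i _ => ?_
  rw [RCLike.star_def, Complex.mul_conj, Complex.normSq_eq_norm_sq, Complex.ofReal_re]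

lemma two_rpow_quarter_sq_sq (n : ℕ) (K : ℝ) :
    (((2 : ℝ) ^ ((n : ℝ) / 4) * 2 ^ (-(1 / 4) * K)) ^ 2) ^ 2 = 2 ^ n * 2 ^ (-K) := by
  rw [← pow_mul, mul_pow, ← Real.rpow_natCast, ← Real.rpow_natCast, ← Real.rpow_mul (by norm_num),
    ← Real.rpow_mul (by norm_num), ← Real.rpow_natCast 2 n]
  congr 2 <;> push_cast <;> ring

end Recovery

end RTN

end

/-- Recovery isometries for random tensor network states with a general background state. The
constant depends only on the number of bulk vertices. -/
theorem mainTheorem5 :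
    ∃ C : ℕ → ℝ,
      ∀ (V : Type*) [Fintype V] [DecidableEq V]
        (ι : V → Type*) [∀ x, Fintype (ι x)] [∀ x, DecidableEq (ι x)] [∀ x, Nonempty (ι x)]
        (κ : Type*) [Fintype κ] [DecidableEq κ]
        (bd A Γ : Finset V) (hA : A ⊆ bd) (_hΓ : RTN.IsCut bd A Γ)
        (v : RTN.Full ι κ → ℂ) (φ : Matrix (RTN.Full ι κ) (RTN.Full ι κ) ℂ)
        (_hφ : φ = RTN.pureState v) (_htr : φ.trace.re ≤ 1)
        (K₁ K₂ : ℝ)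
        (_h₁ : ∀ Δ : Finset V, RTN.IsCut bd A Δ → Δ ⊂ Γ → K₁ ≤ RTN.H2 φ (Γ \ Δ) Γᶜ)
        (_h₂ : ∀ Δ : Finset V, RTN.IsCut bd A Δ → Γ ⊂ Δ → K₂ ≤ RTN.H2 φ (Δ \ Γ) Γ),
        (∀ t : RTN.Tensors ι bd,
          IsLeast (RTN.recoveryErrors hA Γ φ (RTN.networkState bd φ t))
            (RTN.minRecoveryError hA Γ φ (RTN.networkState bd φ t))) ∧
        Integrable (fun t => RTN.minRecoveryError hA Γ φ (RTN.networkState bd φ t))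
          (RTN.tensorLaw ι bd) ∧
        ∫ t, RTN.minRecoveryError hA Γ φ (RTN.networkState bd φ t) ∂(RTN.tensorLaw ι bd) ≤
          C (bdᶜ).card * φ.trace.re ^ (1 / 4 : ℝ) *
            ((2 : ℝ) ^ (-(1 / 4) * K₁) + (2 : ℝ) ^ (-(1 / 4) * K₂)) := by
  refine ⟨fun n => 4 * 2 ^ ((n : ℝ) / 4), ?_⟩
  intro V _ _ ι _ _ _ κ _ _ bd A Γ hA hΓ v φ hφ htr K₁ K₂ h₁ h₂
  subst hφ
  have hAΓ : A ⊆ Γ := by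
    rw [RTN.IsCut] at hΓ
    exact hΓ ▸ Finset.inter_subset_left
  have hBΓ : bd \ A ⊆ Γᶜ := by
    intro x hx
    rw [Finset.mem_sdiff] at hx
    rw [RTN.IsCut] at hΓ
    exact Finset.mem_compl.2 fun h => hx.2 (hΓ ▸ Finset.mem_inter.2 ⟨h, hx.1⟩)
  have key := RTN.integrable_minRecoveryError_and_integral_le hA hΓ h₁ h₂
    (s₁ := 2 ^ (((bdᶜ).card : ℝ) / 4) * 2 ^ (-(1 / 4) * K₁))
    (s₂ := 2 ^ (((bdᶜ).card : ℝ) / 4) * 2 ^ (-(1 / 4) * K₂)) (by positivity) (by positivity)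
    (RTN.two_rpow_quarter_sq_sq _ _) (RTN.two_rpow_quarter_sq_sq _ _)
  refine ⟨fun t => RTN.isLeast_minRecoveryError hA hAΓ hBΓ _ _, key.1, key.2.trans ?_⟩
  rw [RTN.trace_re_pureState] at htr ⊢
  have hn : RTN.nSq v ≤ RTN.nSq v ^ (1 / 4 : ℝ) := by
    have h := Real.rpow_le_rpow_of_exponent_ge' (RTN.nSq_nonneg v) htr
      (by norm_num : (0 : ℝ) ≤ 1 / 4) (by norm_num : (1 / 4 : ℝ) ≤ 1)
    rwa [Real.rpow_one] at h
  calc 4 * (2 ^ (((bdᶜ).card : ℝ) / 4) * 2 ^ (-(1 / 4) * K₁) +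
        2 ^ (((bdᶜ).card : ℝ) / 4) * 2 ^ (-(1 / 4) * K₂)) * RTN.nSq v
      ≤ 4 * (2 ^ (((bdᶜ).card : ℝ) / 4) * 2 ^ (-(1 / 4) * K₁) +
        2 ^ (((bdᶜ).card : ℝ) / 4) * 2 ^ (-(1 / 4) * K₂)) * RTN.nSq v ^ (1 / 4 : ℝ) := by
        gcongr
    _ = _ := by ring
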